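/- Let $n\ge 4$. Let $e_1,\dots,e_n$ be the standard basis of $\mathbb R^n$, and let the simple roots of type $\mathsf D_n$ be $\alpha_j=e_j-e_{j+1}$ for $1\le j\le n-1$ and $\alpha_n=e_{n-1}+e_n$ (Bourbaki's numbering), with highest root $\theta=e_1+e_2$, weight lattice $P$, and fundamental weights $\omega_i=e_1+\dots+e_i$ for $1\le i\le n-2$, $\omega_{n-1}=\tfrac12(e_1+\dots+e_{n-1}-e_n)$, $\omega_n=\tfrac12(e_1+\dots+e_n)$. Let $W_0=\langle s_1,\dots,s_n\rangle$ be the finite Weyl group, where $s_j$ is the reflection in $\alpha_j$, and let $\widetilde W=W_0\ltimes P$ be the extended affine Weyl group of type $\mathsf D_n^{(1)}$, regarded as a group of affine transformations of $\mathbb R^n$; a weight $\lambda\in P$ is identified with the translation $t_\lambda$. Put $s_0=t_\theta s_\theta$, where $s_\theta$ is the reflection in $\theta$. Let $\Lambda\subset\widetilde W$ be the subgroup of elements that permute $\{s_0,\dots,s_n\}$ by conjugation, so that $\widetilde W=\Lambda\ltimes\langle s_0,\dots,s_n\rangle$. The length $\ell(w)$ of $w\in\widetilde W$ is the least $r$ such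 that $w=\lambda s_{j_1}\cdots s_{j_r}$ for some $\lambda\in\Lambda$ and $j_1,\dots,j_r\in\{0,\dots,n\}$; such an expression is called reduced if $r=\ell(w)$. For $j\in\{1,n-1,n\}$ put $\pi_j=\omega_j w_j w_0$, where $w_0$ is the longest element of $W_0$ and $w_j$ is the longest element of the subgroup of $W_0$ generated by the $s_k$ with $1\le k\le n$, $k\ne j$. For $1\le k\le l$ write $[k,l]=s_ks_{k+1}\cdots s_l$ (so $[k,k]=s_k$), and for $2\le m\le n-2$ put \[ r_m=s_n\,[m,n-1]\,[m-1,n-2]. \] Then $\pi_1,\pi_{n-1},\pi_n\in\Lambda$, and the following hold in $\widetilde W$. If $i$ is even, then \[ \omega_i=\begin{cases} \big(s_0[2,n-1][1,n-2]s_n\big)^{i/2}\,[n-i,n-1]\cdots[2,i+1][1,i] & \text{if } 2\le i\le n-2,\\ \pi_{n-1}\,r_{n-2}r_{n-4}\cdots r_3\,s_n[1,n-1] & \text{if } i=n-1,\\ \pi_n\,r_{n-2}r_{n-4}\cdots r_2\,s_n & \text{if } i=n. \end{cases} \] If $i$ is odd, then \[ \omega_i=\begin{cases} \pi_1[1,n-2]s_n\big(s_0[2,n-1][1,n-2]s_n\big)^{(i-1)/2}\,[n-i,n-1]\cdots[2,i+1][1,i]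 & \text{if } 1\le i\le n-2,\\ \pi_{n-1}\,s_{n-1}s_{n-2}\,r_{n-3}r_{n-5}\cdots r_3\,s_n[1,n-1] & \text{if } i=n-1,\\ \pi_n\,s_{n-1}s_{n-2}\,r_{n-3}r_{n-5}\cdots r_2\,s_n & \text{if } i=n. \end{cases} \] Here the indices in the products of the $r_m$ decrease in steps of $2$, and such a product is empty if its first index is smaller than its last one (this happens only for $n=4$, $i=3$). Moreover, all these expressions are reduced, and \[ \ell(\omega_i)=i(2n-i-1)\quad(1\le i\le n-2),\qquad \ell(\omega_{n-1})=\ell(\omega_n)=\frac{n(n-1)}2. \] -/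

import Mathlib

noncomputable section

namespace AffineD

/-! The root system of type `D_n` in `ℝ^n` with Bourbaki's numbering. Coordinates, simple roots and
simple reflections are indexed by natural numbers, as on paper; only the indices `1, …, n`
(and `0` for the affine node) are meaningful. -/

/-- The standard basis vector `e_k` of `ℝ^n`, for `1 ≤ k ≤ n`. -/
def e (n k : ℕ) : Fin n → ℝ := fun a => if (a : ℕ) + 1 = k then 1 else 0

/-- The simple roots `α_j = e_j - e_{j+1}` for `1 ≤ j ≤ n - 1`, and `α_n = e_{n-1} + e_n`. -/
def simpleRoot (n j : ℕ) : Fin n → ℝ :=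
  if j < n then e n j - e n (j + 1) else e n (n - 1) + e n n

/-- The highest root `θ = e_1 + e_2`. -/
def highestRoot (n : ℕ) : Fin n → ℝ := e n 1 + e n 2

/-- The fundamental weights: `ω_i = e_1 + ⋯ + e_i` for `1 ≤ i ≤ n - 2`,
`ω_{n-1} = (e_1 + ⋯ + e_{n-1} - e_n) / 2` and `ω_n = (e_1 + ⋯ + e_{n-1} + e_n) / 2`. -/
def fundamentalWeight (n i : ℕ) : Fin n → ℝ :=
  if i + 2 ≤ n then ∑ k ∈ Finset.Icc 1 i, e n k
  else if i + 1 = n then (1 / 2 : ℝ) • (∑ k ∈ Finset.Icc 1 (n - 1), e n k - e n n)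
  else (1 / 2 : ℝ) • ∑ k ∈ Finset.Icc 1 n, e n k

theorem dot_e (n k : ℕ) (v : Fin n → ℝ) (hk : 1 ≤ k) (hkn : k ≤ n) :
    e n k ⬝ᵥ v = v ⟨k - 1, by omega⟩ := by
  unfold e dotProduct
  rw [Finset.sum_eq_single (⟨k - 1, by omega⟩ : Fin n)]
  · have : k - 1 + 1 = k := by omega
    simp [this]
  · intro b _ hb
    have : (b : ℕ) + 1 ≠ k := fun h => hb (Fin.ext (by simp; omega))
    simp [this]
  · simp

theorem sum_e_apply (n m : ℕ) (a : Fin n) :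
    (∑ k ∈ Finset.Icc 1 m, e n k) a = if (a : ℕ) + 1 ≤ m then 1 else 0 := by
  simp [e, Finset.sum_apply]

/-- The fundamental weights are dual to the simple (co)roots. -/
theorem simpleRoot_dot_fundamentalWeight (n i j : ℕ) (hn : 4 ≤ n) (hin : i ≤ n)
    (hj : 1 ≤ j) (hjn : j ≤ n) :
    simpleRoot n j ⬝ᵥ fundamentalWeight n i = if i = j then 1 else 0 := by
  have key : ∀ a : Fin n, fundamentalWeight n i a =
      if i + 2 ≤ n then (if (a : ℕ) + 1 ≤ i then 1 else 0)
      else if i + 1 = n ∧ (a : ℕ) + 1 = n then -(1 / 2) else 1 / 2 := by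
    intro a
    have := a.2
    unfold fundamentalWeight
    split_ifs <;> simp [sum_e_apply, -Finset.sum_apply, e] <;> grind
  unfold simpleRoot
  split_ifs with h1 h2 h2
  all_goals
    first
      | rw [sub_dotProduct]
      | rw [add_dotProduct]
    rw [dot_e n _ _ (by omega) (by omega), dot_e n _ _ (by omega) (by omega), key, key]
    grind

/-- The orthogonal reflection `x ↦ x - 2 (v, x) / (v, v) • v` in the hyperplane `v^⊥`, as a linear
map. -/
def reflLin (n : ℕ) (v : Fin n → ℝ) : (Fin n → ℝ) →ₗ[ℝ] (Fin n → ℝ) where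
  toFun x := x - (2 * (v ⬝ᵥ x) / (v ⬝ᵥ v)) • v
  map_add' x y := by
    rw [dotProduct_add]; module
  map_smul' c x := by
    rw [dotProduct_smul, smul_eq_mul, RingHom.id_apply]; module

theorem reflLin_involutive (n : ℕ) (v : Fin n → ℝ) : Function.Involutive (reflLin n v) := by
  intro x
  by_cases h : v ⬝ᵥ v = 0
  · simp [reflLin, h]
  · have : v ⬝ᵥ (x - (2 * (v ⬝ᵥ x) / (v ⬝ᵥ v)) • v) = -(v ⬝ᵥ x) := by
      rw [dotProduct_sub, dotProduct_smul, smul_eq_mul]; field_simp; ring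
    change (x - (2 * (v ⬝ᵥ x) / (v ⬝ᵥ v)) • v) -
      (2 * (v ⬝ᵥ (x - (2 * (v ⬝ᵥ x) / (v ⬝ᵥ v)) • v)) / (v ⬝ᵥ v)) • v = x
    rw [this]; module

/-- The group of affine transformations of `ℝ^n`; multiplication is composition. -/
abbrev AffineGroup (n : ℕ) := (Fin n → ℝ) ≃ᵃ[ℝ] (Fin n → ℝ)

/-- The reflection `s_v` as an affine transformation. -/
def refl (n : ℕ) (v : Fin n → ℝ) : AffineGroup n :=
  (LinearEquiv.ofInvolutive (reflLin n v) (reflLin_involutive n v)).toAffineEquiv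

/-- The translation `t_v : x ↦ v + x`. -/
def translation (n : ℕ) (v : Fin n → ℝ) : AffineGroup n :=
  AffineEquiv.constVAdd ℝ (Fin n → ℝ) v

/-- The simple reflections: `s_0 = t_θ s_θ` and `s_j = s_{α_j}` for `1 ≤ j ≤ n`. -/
def s (n j : ℕ) : AffineGroup n :=
  if j = 0 then translation n (highestRoot n) * refl n (highestRoot n)
  else refl n (simpleRoot n j)

/-- The set `{s_0, s_1, …, s_n}`. -/
def simpleReflections (n : ℕ) : Set (AffineGroup n) := s n '' Set.Icc 0 n

/-- The weight lattice `P`: the vectors that pair integrally with all simple coroots (which are the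
simple roots under the identification given by the standard scalar product). -/
def weightLattice (n : ℕ) : Set (Fin n → ℝ) :=
  {x | ∀ j, 1 ≤ j → j ≤ n → ∃ c : ℤ, simpleRoot n j ⬝ᵥ x = c}

/-- The extended affine Weyl group `W_0 ⋉ P`, as a group of affine transformations of `ℝ^n`:
generated by the finite Weyl group `W_0 = ⟨s_1, …, s_n⟩` and the translations by `P`. -/
def extAffineWeyl (n : ℕ) : Subgroup (AffineGroup n) :=
  Subgroup.closure (s n '' Set.Icc 1 n) ⊔ Subgroup.closure (translation n '' weightLattice n)

/-- The group `Λ` of diagram automorphisms in the extended affine Weyl group: the elements that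
permute the simple reflections `s_0, …, s_n` by conjugation. -/
def diagramGroup (n : ℕ) : Subgroup (AffineGroup n) :=
  extAffineWeyl n ⊓ Subgroup.normalizer (simpleReflections n)

/-- The product `s_{j_1} s_{j_2} ⋯ s_{j_r}` of a word `j_1, j_2, …, j_r`. -/
def wordProd (n : ℕ) (L : List ℕ) : AffineGroup n := (L.map (s n)).prod

/-- The length function of the extended affine Weyl group `Λ ⋉ W`: the least `r` such that
`g = lam s_{j_1} ⋯ s_{j_r}` with `lam ∈ Λ` and `j_1, …, j_r ∈ {0, …, n}`. -/
def extLength (n : ℕ) (g : AffineGroup n) : ℕ :=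
  sInf {r | ∃ lam ∈ diagramGroup n, ∃ L : List ℕ,
    (∀ j ∈ L, j ≤ n) ∧ L.length = r ∧ g = lam * wordProd n L}

/-- `g = lam s_{j_1} ⋯ s_{j_r}` is a reduced expression for `g`: `lam ∈ Λ`, the letters are in
`{0, …, n}`, and the number of letters is the length of `g`. -/
def IsReducedExpression (n : ℕ) (g lam : AffineGroup n) (L : List ℕ) : Prop :=
  lam ∈ diagramGroup n ∧ (∀ j ∈ L, j ≤ n) ∧ g = lam * wordProd n L ∧ L.length = extLength n g

/-! Longest elements of standard parabolic subgroups, and the elements `π_j` of `Λ`. -/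

/-- The Coxeter length on the parabolic subgroup `W_I = ⟨s_j | j ∈ I⟩`. -/
def parabolicLength (n : ℕ) (I : Set ℕ) (w : AffineGroup n) : ℕ :=
  sInf {r | ∃ L : List ℕ, (∀ j ∈ L, j ∈ I) ∧ L.length = r ∧ w = wordProd n L}

/-- `w` is an element of maximal length of `W_I`. -/
def IsLongest (n : ℕ) (I : Set ℕ) (w : AffineGroup n) : Prop :=
  w ∈ Subgroup.closure (s n '' I) ∧
    ∀ u ∈ Subgroup.closure (s n '' I), parabolicLength n I u ≤ parabolicLength n I w

/-- The longest element of `W_I` (used for finite `W_I`, where it exists and is unique). -/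
def longest (n : ℕ) (I : Set ℕ) : AffineGroup n := Classical.epsilon (IsLongest n I)

/-- `π_j = ω_j w_j w_0`, where `w_0` is the longest element of `W_0` and `w_j` is the longest element
of the parabolic subgroup obtained by removing the node `j`. -/
def diagramAut (n j : ℕ) : AffineGroup n :=
  translation n (fundamentalWeight n j) * longest n (Set.Icc 1 n \ {j}) * longest n (Set.Icc 1 n)

/-! Words in the letters `0, …, n`. -/

/-- The block `[k,l] = s_k s_{k+1} ⋯ s_l`, for `k ≤ l`. -/
def block (k l : ℕ) : List ℕ := List.range' k (l + 1 - k)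

/-- The `k`-th power of a word. -/
def wordPow (L : List ℕ) (k : ℕ) : List ℕ := (List.replicate k L).flatten

/-- The word `[n-i,n-1] [n-i-1,n-2] ⋯ [2,i+1] [1,i]`. -/
def cyclicWord (n i : ℕ) : List ℕ :=
  (List.range (n - i)).flatMap fun t => block (n - i - t) (n - 1 - t)

/-- `r_m = s_n [m,n-1] [m-1,n-2]`. -/
def rWord (n m : ℕ) : List ℕ := [n] ++ block m (n - 1) ++ block (m - 1) (n - 2)

/-- `r_a r_{a-2} r_{a-4} ⋯ r_b`, for `a ≡ b` modulo `2`; it is empty if `a < b`. -/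
def rChain (n a b : ℕ) : List ℕ :=
  (List.range ((a + 2 - b) / 2)).flatMap fun t => rWord n (a - 2 * t)

end AffineD

end

/-! The number of affine root hyperplanes that separate a point from the fundamental alcove is
evaluated at `g (ρ / h)`, where `h = 2n - 2` is the Coxeter number. Elements of `Λ` permute the
walls of the alcove and hence fix `ρ / h`, while left multiplication by `s_j` changes the count
by at most one. So the count at `g (ρ / h)` is a lower bound for the length of `g`, and an
expression with that many letters is reduced; for `g = t_{ω_i}` the count is the sum of
`(α, ω_i)` over the positive roots `α`. The identities between affine transformations are checked on
coordinates: the words act by signed permutations followed by translations, and the longest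
elements `w_0` and `w_j` are the signed permutations with the right signs on the simple roots,
because only the identity of `W_0` maps an interior point of the dominant chamber into the
dominant chamber. -/

noncomputable section

namespace AffineD

variable {n : ℕ}

theorem mul_apply (g h : AffineGroup n) (x : Fin n → ℝ) : (g * h) x = g (h x) := rfl

theorem translation_apply (v x : Fin n → ℝ) : translation n v x = v + x := rfl

theorem refl_apply (v x : Fin n → ℝ) : refl n v x = x - (2 * (v ⬝ᵥ x) / (v ⬝ᵥ v)) • v := rfl

/-- The coordinate `x_k` of a vector, for `1 ≤ k ≤ n`, and `0` for other `k`. -/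
def coord (x : Fin n → ℝ) (k : ℕ) : ℝ :=
  if h : 1 ≤ k ∧ k ≤ n then x ⟨k - 1, by omega⟩ else 0

theorem apply_eq_coord (x : Fin n → ℝ) (a : Fin n) : x a = coord x (a + 1) := by
  simp [coord, show (a : ℕ) + 1 ≤ n by omega]

theorem coord_of_fun (f : ℕ → ℝ) {k : ℕ} (h1 : 1 ≤ k) (h2 : k ≤ n) :
    coord (fun a : Fin n => f (a + 1)) k = f k := by
  simp [coord, h1, h2]

theorem coord_ext {x y : Fin n → ℝ} (h : ∀ k, 1 ≤ k → k ≤ n → coord x k = coord y k) : x = y := by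
  ext a
  rw [apply_eq_coord x, apply_eq_coord y, h (a + 1) (by omega) (by omega)]

theorem coord_add (x y : Fin n → ℝ) (k : ℕ) : coord (x + y) k = coord x k + coord y k := by
  unfold coord; split_ifs <;> simp

theorem coord_sub (x y : Fin n → ℝ) (k : ℕ) : coord (x - y) k = coord x k - coord y k := by
  unfold coord; split_ifs <;> simp

theorem coord_neg (x : Fin n → ℝ) (k : ℕ) : coord (-x) k = -coord x k := by
  unfold coord; split_ifs <;> simp

theorem coord_smul (c : ℝ) (x : Fin n → ℝ) (k : ℕ) : coord (c • x) k = c * coord x k := by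
  unfold coord; split_ifs <;> simp

theorem coord_translation (v x : Fin n → ℝ) (k : ℕ) :
    coord (translation n v x) k = coord v k + coord x k := by
  rw [translation_apply, coord_add]

theorem coord_e {j : ℕ} (h1 : 1 ≤ j) (h2 : j ≤ n) (k : ℕ) :
    coord (e n j) k = if k = j then 1 else 0 := by
  unfold coord e
  split_ifs <;> grind

theorem e_dot_eq_coord {j : ℕ} (h1 : 1 ≤ j) (h2 : j ≤ n) (x : Fin n → ℝ) :
    e n j ⬝ᵥ x = coord x j := by
  rw [dot_e n j x h1 h2]; simp [coord, h1, h2]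

theorem coord_fundamentalWeight (hn : 4 ≤ n) {i k : ℕ} (hk : 1 ≤ k) (hkn : k ≤ n) :
    coord (fundamentalWeight n i) k =
      if i + 2 ≤ n then (if k ≤ i then 1 else 0)
      else if i + 1 = n ∧ k = n then -(1 / 2) else 1 / 2 := by
  simp only [coord, hk, hkn, and_self, dite_true]
  unfold fundamentalWeight
  split_ifs <;> simp [sum_e_apply, -Finset.sum_apply, e] <;> grind

theorem simpleRoot_dot {j : ℕ} (hj : 1 ≤ j) (hjn : j < n) (x : Fin n → ℝ) :
    simpleRoot n j ⬝ᵥ x = coord x j - coord x (j + 1) := by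
  rw [simpleRoot, if_pos hjn, sub_dotProduct, e_dot_eq_coord hj hjn.le,
    e_dot_eq_coord (by omega) (by omega)]

theorem simpleRoot_last_dot (hn : 2 ≤ n) (x : Fin n → ℝ) :
    simpleRoot n n ⬝ᵥ x = coord x (n - 1) + coord x n := by
  rw [simpleRoot, if_neg (lt_irrefl n), add_dotProduct, e_dot_eq_coord (by omega) (by omega),
    e_dot_eq_coord (by omega) le_rfl]

theorem highestRoot_dot (hn : 2 ≤ n) (x : Fin n → ℝ) :
    highestRoot n ⬝ᵥ x = coord x 1 + coord x 2 := by
  rw [highestRoot, add_dotProduct, e_dot_eq_coord (by omega) (by omega),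
    e_dot_eq_coord (by omega) (by omega)]

/-- The inward normal vector of the `j`-th wall of the fundamental alcove: the simple root `α_j`
for `j ≠ 0`, and `-θ` for `j = 0`. -/
def wallNormal (n j : ℕ) : Fin n → ℝ := if j = 0 then -highestRoot n else simpleRoot n j

/-- The affine simple root `α_j`, or `1 - θ` for `j = 0`, as a function on `ℝ^n`: it vanishes on
the `j`-th wall of the fundamental alcove and is positive inside. -/
def wall (n j : ℕ) (x : Fin n → ℝ) : ℝ := (if j = 0 then 1 else 0) + wallNormal n j ⬝ᵥ x

theorem wall_zero (hn : 2 ≤ n) (x : Fin n → ℝ) : wall n 0 x = 1 - (coord x 1 + coord x 2) := by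
  rw [wall, wallNormal, if_pos rfl, if_pos rfl, neg_dotProduct, highestRoot_dot hn, sub_eq_add_neg]

theorem wall_eq_simpleRoot_dot {j : ℕ} (hj : 1 ≤ j) (x : Fin n → ℝ) :
    wall n j x = simpleRoot n j ⬝ᵥ x := by
  rw [wall, wallNormal, if_neg (by omega), if_neg (by omega), zero_add]

theorem wall_of_lt {j : ℕ} (hj : 1 ≤ j) (hjn : j < n) (x : Fin n → ℝ) :
    wall n j x = coord x j - coord x (j + 1) := by
  rw [wall_eq_simpleRoot_dot hj, simpleRoot_dot hj hjn]

theorem wall_last (hn : 2 ≤ n) (x : Fin n → ℝ) : wall n n x = coord x (n - 1) + coord x n := by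
  rw [wall_eq_simpleRoot_dot (by omega), simpleRoot_last_dot hn]

theorem wall_add (j : ℕ) (x v : Fin n → ℝ) :
    wall n j (x + v) = wall n j x + wallNormal n j ⬝ᵥ v := by
  rw [wall, wall, dotProduct_add, add_assoc]

theorem coord_wallNormal_zero (hn : 2 ≤ n) (k : ℕ) :
    coord (wallNormal n 0) k = if k = 1 ∨ k = 2 then -1 else 0 := by
  rw [wallNormal, if_pos rfl, highestRoot, coord_neg, coord_add, coord_e le_rfl (by omega),
    coord_e (by omega) hn]
  grind

theorem coord_wallNormal_of_lt {j : ℕ} (hj : 1 ≤ j) (hjn : j < n) (k : ℕ) :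
    coord (wallNormal n j) k = if k = j then 1 else if k = j + 1 then -1 else 0 := by
  rw [wallNormal, if_neg (by omega), simpleRoot, if_pos hjn, coord_sub, coord_e hj hjn.le,
    coord_e (by omega) hjn]
  grind

theorem coord_wallNormal_last (hn : 2 ≤ n) (k : ℕ) :
    coord (wallNormal n n) k = if k = n - 1 ∨ k = n then 1 else 0 := by
  rw [wallNormal, if_neg (by omega), simpleRoot, if_neg (lt_irrefl n), coord_add,
    coord_e (by omega) (by omega), coord_e (by omega) le_rfl]
  grind

theorem wallNormal_dot_self (hn : 2 ≤ n) {j : ℕ} (hj : j ≤ n) :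
    wallNormal n j ⬝ᵥ wallNormal n j = 2 := by
  have hdot := wall_add j 0 (wallNormal n j)
  obtain rfl | hj0 := Nat.eq_zero_or_pos j
  · rw [wall_zero hn, wall_zero hn] at hdot
    simp only [coord_add, coord_wallNormal_zero hn] at hdot
    grind
  obtain rfl | hjn := hj.eq_or_lt
  · rw [wall_last hn, wall_last hn] at hdot
    simp only [coord_add, coord_wallNormal_last hn] at hdot
    grind
  · rw [wall_of_lt hj0 hjn, wall_of_lt hj0 hjn] at hdot
    simp only [coord_add, coord_wallNormal_of_lt hj0 hjn] at hdot
    grind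

theorem s_apply (hn : 2 ≤ n) {j : ℕ} (hj : j ≤ n) (x : Fin n → ℝ) :
    s n j x = x - wall n j x • wallNormal n j := by
  have hnorm := wallNormal_dot_self hn hj
  rw [s, wall]
  unfold wallNormal at hnorm ⊢
  split_ifs with h
  · rw [if_pos h, neg_dotProduct_neg] at hnorm
    rw [mul_apply, translation_apply, refl_apply, hnorm, neg_dotProduct]
    module
  · rw [if_neg h] at hnorm
    rw [refl_apply, hnorm]
    module

theorem wall_s_self (hn : 2 ≤ n) {j : ℕ} (hj : j ≤ n) (x : Fin n → ℝ) :
    wall n j (s n j x) = -wall n j x := by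
  rw [s_apply hn hj, sub_eq_add_neg, wall_add, dotProduct_neg, dotProduct_smul,
    wallNormal_dot_self hn hj, smul_eq_mul]
  ring

theorem s_mul_self (hn : 2 ≤ n) {j : ℕ} (hj : j ≤ n) : s n j * s n j = 1 := by
  ext1 x
  rw [mul_apply, s_apply hn hj, wall_s_self hn hj, s_apply hn hj]
  simp

theorem coord_s_zero (hn : 2 ≤ n) (x : Fin n → ℝ) (k : ℕ) :
    coord (s n 0 x) k =
      if k = 1 then 1 - coord x 2 else if k = 2 then 1 - coord x 1 else coord x k := by
  rw [s_apply hn n.zero_le, coord_sub, coord_smul, wall_zero hn, coord_wallNormal_zero hn]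
  grind

theorem coord_s {j : ℕ} (hj : 1 ≤ j) (hjn : j < n) (x : Fin n → ℝ) (k : ℕ) :
    coord (s n j x) k =
      if k = j then coord x (j + 1) else if k = j + 1 then coord x j else coord x k := by
  rw [s_apply (by omega) hjn.le, coord_sub, coord_smul, wall_of_lt hj hjn,
    coord_wallNormal_of_lt hj hjn]
  grind

theorem coord_s_last (hn : 2 ≤ n) (x : Fin n → ℝ) (k : ℕ) :
    coord (s n n x) k =
      if k = n - 1 then -coord x n else if k = n then -coord x (n - 1) else coord x k := by
  rw [s_apply hn le_rfl, coord_sub, coord_smul, wall_last hn, coord_wallNormal_last hn]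
  grind

theorem wordProd_nil : wordProd n [] = 1 := rfl

theorem wordProd_singleton (j : ℕ) : wordProd n [j] = s n j := by simp [wordProd]

theorem wordProd_cons (j : ℕ) (L : List ℕ) : wordProd n (j :: L) = s n j * wordProd n L := by
  simp [wordProd]

theorem wordProd_append (A B : List ℕ) : wordProd n (A ++ B) = wordProd n A * wordProd n B := by
  simp [wordProd]

theorem wordProd_wordPow (L : List ℕ) (k : ℕ) : wordProd n (wordPow L k) = wordProd n L ^ k := by
  induction k with
  | zero => rfl
  | succ k ih => rw [pow_succ', ← ih, ← wordProd_append]; rfl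

theorem block_succ {k l : ℕ} (h : k ≤ l + 1) : block k (l + 1) = block k l ++ [l + 1] := by
  unfold block
  rw [show l + 1 + 1 - k = (l + 1 - k) + 1 by omega, List.range'_concat]
  congr 2; omega

theorem coord_block {k l : ℕ} (hk : 1 ≤ k) (hkl : k ≤ l) (hl : l < n) (x : Fin n → ℝ) (p : ℕ) :
    coord (wordProd n (block k l) x) p =
      if p = k then coord x (l + 1) else if k < p ∧ p ≤ l + 1 then coord x (p - 1)
      else coord x p := by
  induction l, hkl using Nat.le_induction generalizing x with
  | base =>
    simp only [block, Nat.add_sub_cancel_left, List.range'_one, wordProd_singleton]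
    rw [coord_s hk hl]
    grind
  | succ l hkl ih =>
    rw [block_succ (by omega), wordProd_append, wordProd_singleton, mul_apply, ih (by omega)]
    simp only [coord_s (show 1 ≤ l + 1 by omega) hl]
    grind

theorem coord_flatMap_block {i : ℕ} (hi : 1 ≤ i) (m : ℕ) (hm : m + i ≤ n) (x : Fin n → ℝ)
    {p : ℕ} (hp : 1 ≤ p) :
    coord (wordProd n ((List.range m).flatMap fun t => block (m - t) (m + i - 1 - t)) x) p =
      if p ≤ m then coord x (p + i) else if p ≤ m + i then coord x (p - m) else coord x p := by
  induction m generalizing p with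
  | zero => simp [wordProd_nil, show ¬ p ≤ 0 by omega]
  | succ m ih =>
    have hshift : ∀ t, block (m + 1 - t.succ) (m + 1 + i - 1 - t.succ) =
        block (m - t) (m + i - 1 - t) := fun t => by congr 1 <;> omega
    rw [List.range_succ_eq_map, List.flatMap_cons, List.flatMap_map, wordProd_append, mul_apply]
    simp only [hshift]
    rw [coord_block (by omega) (by omega) (by omega)]
    split_ifs <;> rw [ih (by omega) (by omega)] <;> clear ih hshift <;> grind

theorem coord_cyclicWord {i : ℕ} (hi : 1 ≤ i) (hin : i ≤ n) (x : Fin n → ℝ) {p : ℕ} (hp : 1 ≤ p)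
    (hpn : p ≤ n) :
    coord (wordProd n (cyclicWord n i) x) p =
      if p ≤ n - i then coord x (p + i) else coord x (p - (n - i)) := by
  have := coord_flatMap_block hi (n - i) (by omega) x hp
  rw [show n - i + i = n by omega] at this
  rw [cyclicWord, this]
  grind

/-- The word `0 [2,n-1] [1,n-2] n`. It acts on `ℝ^n` as the cyclic rotation of the coordinates by
two positions, followed by the translation by `e_1 + e_2`. -/
def rotationWord (n : ℕ) : List ℕ := [0] ++ block 2 (n - 1) ++ block 1 (n - 2) ++ [n]

theorem coord_rotationWord (hn : 4 ≤ n) (x : Fin n → ℝ) {p : ℕ} (hp : 1 ≤ p) (hpn : p ≤ n) :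
    coord (wordProd n (rotationWord n) x) p =
      if p ≤ 2 then 1 + coord x (n - 2 + p) else coord x (p - 2) := by
  simp only [rotationWord, wordProd_append, mul_apply, wordProd_singleton]
  simp only [coord_s_zero (show 2 ≤ n by omega),
    coord_block (show 1 ≤ 2 by omega) (show 2 ≤ n - 1 by omega) (show n - 1 < n by omega),
    coord_block (show 1 ≤ 1 by omega) (show 1 ≤ n - 2 by omega) (show n - 2 < n by omega),
    coord_s_last (show 2 ≤ n by omega)]
  grind

theorem coord_wordPow_rotationWord (hn : 4 ≤ n) {k : ℕ} (hk : 2 * k ≤ n) (x : Fin n → ℝ) {p : ℕ}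
    (hp : 1 ≤ p) (hpn : p ≤ n) :
    coord (wordProd n (wordPow (rotationWord n) k) x) p =
      if p ≤ 2 * k then 1 + coord x (n - 2 * k + p) else coord x (p - 2 * k) := by
  rw [wordProd_wordPow]
  induction k generalizing p with
  | zero => simp [show ¬ p ≤ 0 by omega]
  | succ k ih =>
    rw [pow_succ', mul_apply, coord_rotationWord hn _ hp hpn]
    split_ifs <;> rw [ih (by omega) (by omega) (by omega)] <;> clear ih <;> grind

theorem coord_block_one_append_last (hn : 3 ≤ n) (x : Fin n → ℝ) {p : ℕ} (hp : 1 ≤ p)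
    (hpn : p ≤ n) :
    coord (wordProd n (block 1 (n - 2) ++ [n]) x) p =
      if p = 1 then -coord x n else if p = n then -coord x (n - 1) else coord x (p - 1) := by
  rw [wordProd_append, wordProd_singleton, mul_apply,
    coord_block le_rfl (by omega) (by omega)]
  simp only [coord_s_last (show 2 ≤ n by omega)]
  grind

theorem coord_rWord {m : ℕ} (hm : 2 ≤ m) (hmn : m + 2 ≤ n) (x : Fin n → ℝ) {p : ℕ} (hp : 1 ≤ p)
    (hpn : p ≤ n) :
    coord (wordProd n (rWord n m) x) p =
      if p + 2 ≤ m then coord x p else if p ≤ m then coord x (n + p - m)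
      else if p + 2 ≤ n then coord x (p - 2) else -coord x (2 * n - 3 - p) := by
  simp only [rWord, wordProd_append, mul_apply, wordProd_singleton]
  simp only [coord_s_last (show 2 ≤ n by omega),
    coord_block (show 1 ≤ m by omega) (show m ≤ n - 1 by omega) (show n - 1 < n by omega),
    coord_block (show 1 ≤ m - 1 by omega) (show m - 1 ≤ n - 2 by omega) (show n - 2 < n by omega)]
  grind

theorem rChain_of_lt {a b : ℕ} (h : a < b) : rChain n a b = [] := by
  simp [rChain, show (a + 2 - b) / 2 = 0 by omega]

theorem rChain_add_two {a b : ℕ} (h : b ≤ a + 2) :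
    rChain n (a + 2) b = rWord n (a + 2) ++ rChain n a b := by
  unfold rChain
  rw [show (a + 2 + 2 - b) / 2 = (a + 2 - b) / 2 + 1 by omega, List.range_succ_eq_map,
    List.flatMap_cons, List.flatMap_map]
  congr 2
  funext t
  congr 1
  omega

theorem coord_rChain_append_last {m : ℕ} (hn : 2 ≤ n) (hmn : 2 * m + 2 ≤ n) (x : Fin n → ℝ) {p : ℕ}
    (hp : 1 ≤ p) (hpn : p ≤ n) :
    coord (wordProd n (rChain n (2 * m) 2 ++ [n]) x) p =
      if p ≤ 2 * m then -coord x (n + 1 - p) else if p + 2 ≤ n then coord x (p - 2 * m)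
      else -coord x (2 * n - 1 - 2 * m - p) := by
  induction m generalizing p with
  | zero =>
    rw [rChain_of_lt (by omega), List.nil_append, wordProd_singleton, coord_s_last hn]
    grind
  | succ m ih =>
    rw [Nat.mul_succ, rChain_add_two (by omega), List.append_assoc, wordProd_append, mul_apply,
      coord_rWord (by omega) (by omega) _ hp hpn]
    split_ifs <;> rw [ih (by omega) (by omega) (by omega)] <;> clear ih <;> grind

theorem coord_rChain_append_last_block {m : ℕ} (hn : 3 ≤ n) (hmn : 2 * m + 3 ≤ n) (x : Fin n → ℝ)
    {p : ℕ} (hp : 1 ≤ p) (hpn : p ≤ n) :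
    coord (wordProd n (rChain n (2 * m + 1) 3 ++ [n] ++ block 1 (n - 1)) x) p =
      if p = 1 then coord x n else if p ≤ 2 * m + 1 then -coord x (n + 1 - p)
      else if p + 2 ≤ n then coord x (p - 2 * m - 1)
      else -coord x (2 * n - 2 - 2 * m - p) := by
  induction m generalizing p with
  | zero =>
    rw [rChain_of_lt (by omega), List.nil_append, wordProd_append, wordProd_singleton, mul_apply,
      coord_s_last (by omega)]
    simp only [coord_block le_rfl (show 1 ≤ n - 1 by omega) (show n - 1 < n by omega)]
    grind
  | succ m ih =>
    rw [show 2 * (m + 1) + 1 = 2 * m + 1 + 2 by omega, rChain_add_two (by omega),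
      List.append_assoc, List.append_assoc, wordProd_append, mul_apply, ← List.append_assoc,
      coord_rWord (by omega) (by omega) _ hp hpn]
    split_ifs <;> rw [ih (by omega) (by omega) (by omega)] <;> clear ih <;> grind

theorem length_block (k l : ℕ) : (block k l).length = l + 1 - k := by simp [block]

theorem length_wordPow (L : List ℕ) (k : ℕ) : (wordPow L k).length = k * L.length := by
  simp [wordPow]

theorem length_rotationWord (hn : 3 ≤ n) : (rotationWord n).length = 2 * (n - 1) := by
  simp [rotationWord, length_block]; omega

theorem length_cyclicWord {i : ℕ} (hi : 1 ≤ i) (hin : i ≤ n) :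
    (cyclicWord n i).length = (n - i) * i := by
  rw [cyclicWord, List.length_flatMap, List.map_congr_left (g := fun _ => i)]
  · simp
  · intro t ht
    have := List.mem_range.1 ht
    rw [length_block]; omega

theorem length_rWord {m : ℕ} (hm : 2 ≤ m) (hmn : m ≤ n) :
    (rWord n m).length = 2 * (n - m) + 1 := by
  simp [rWord, length_block]; omega

theorem length_rChain {b m : ℕ} (hb : 2 ≤ b) (hbn : b + 2 * m ≤ n + 2) :
    (rChain n (b + 2 * m - 2) b).length = m * (2 * n + 3 - 2 * b - 2 * m) := by
  induction m with
  | zero => rw [rChain_of_lt (by omega), List.length_nil, zero_mul]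
  | succ m ih =>
    obtain ⟨d, rfl⟩ : ∃ d, n = b + 2 * m + d := ⟨n - b - 2 * m, by omega⟩
    rw [show b + 2 * (m + 1) - 2 = b + 2 * m - 2 + 2 by omega, rChain_add_two (by omega),
      List.length_append, ih (by omega), length_rWord (by omega) (by omega)]
    rw [show 2 * (b + 2 * m + d) + 3 - 2 * b - 2 * m = 2 * m + 2 * d + 3 by omega,
      show 2 * (b + 2 * m + d) + 3 - 2 * b - 2 * (m + 1) = 2 * m + 2 * d + 1 by omega,
      show b + 2 * m + d - (b + 2 * m - 2 + 2) = d by omega]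
    ring

theorem le_of_mem_block {k l j N : ℕ} (hl : l ≤ N) (h : j ∈ block k l) : j ≤ N := by
  simp only [block, List.mem_range'_1] at h; omega

theorem le_of_mem_wordPow {L : List ℕ} {k j N : ℕ} (hL : ∀ j ∈ L, j ≤ N) (h : j ∈ wordPow L k) :
    j ≤ N := by
  simp only [wordPow, List.mem_flatten, List.mem_replicate] at h
  obtain ⟨M, ⟨-, rfl⟩, hj⟩ := h
  exact hL j hj

theorem le_of_mem_rotationWord {j : ℕ} (h : j ∈ rotationWord n) : j ≤ n := by
  simp only [rotationWord, List.mem_append, List.mem_singleton] at h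
  obtain ((rfl | h) | h) | rfl := h
  exacts [n.zero_le, le_of_mem_block (by omega) h, le_of_mem_block (by omega) h, le_rfl]

theorem le_of_mem_cyclicWord {i j : ℕ} (h : j ∈ cyclicWord n i) : j ≤ n := by
  simp only [cyclicWord, List.mem_flatMap] at h
  obtain ⟨t, -, h⟩ := h
  exact le_of_mem_block (by omega) h

theorem le_of_mem_rChain {a b j : ℕ} (h : j ∈ rChain n a b) : j ≤ n := by
  simp only [rChain, List.mem_flatMap, rWord, List.mem_append, List.mem_singleton] at h
  obtain ⟨t, -, (rfl | h) | h⟩ := h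
  exacts [le_rfl, le_of_mem_block (by omega) h, le_of_mem_block (by omega) h]

/-- The number of integers that strictly separate `t` from the open interval `(0, 1)`. -/
def crossings (t : ℝ) : ℕ := (⌈t⌉ - 1).toNat + (-⌊t⌋).toNat

theorem crossings_one_sub (t : ℝ) : crossings (1 - t) = crossings t := by
  have hceil : ⌈1 - t⌉ = 1 - ⌊t⌋ := by
    rw [sub_eq_neg_add, Int.ceil_add_one, Int.ceil_neg]; ring
  have hfloor : ⌊1 - t⌋ = 1 - ⌈t⌉ := by
    rw [sub_eq_neg_add, Int.floor_add_one, Int.floor_neg]; ring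
  rw [crossings, crossings, hceil, hfloor]
  omega

theorem crossings_neg_of_pos {t : ℝ} (ht : 0 < t) : crossings (-t) = crossings t + 1 := by
  have hfloor : 0 ≤ ⌊t⌋ := Int.floor_nonneg.2 ht.le
  have hceil : 0 < ⌈t⌉ := Int.ceil_pos.2 ht
  rw [crossings, crossings, Int.ceil_neg, Int.floor_neg]
  omega

theorem crossings_neg_le (t : ℝ) : crossings (-t) ≤ crossings t + 1 := by
  obtain ht | rfl | ht := lt_trichotomy t 0
  · have := crossings_neg_of_pos (neg_pos.2 ht)
    rw [neg_neg] at this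
    omega
  · rw [neg_zero]; exact Nat.le_succ _
  · exact (crossings_neg_of_pos ht).le

theorem crossings_sub_natCast {t : ℝ} (h0 : 0 < t) (h1 : t < 1) (k : ℕ) :
    crossings (t - k) = k := by
  have hceil : ⌈t⌉ = 1 := Int.ceil_eq_iff.2 ⟨by norm_num [h0], by norm_num [h1.le]⟩
  have hfloor : ⌊t⌋ = 0 := Int.floor_eq_zero_iff.2 ⟨h0.le, h1⟩
  rw [crossings, Int.ceil_sub_natCast, Int.floor_sub_natCast, hceil, hfloor]
  omega

/-- The number of hyperplanes `{x | x_a - x_b = k}` and `{x | x_a + x_b = k}`, with `k` an integer,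
that separate a point with `x_a = u`, `x_b = v` from the fundamental alcove. -/
def pairSep (u v : ℝ) : ℕ := crossings (u - v) + crossings (u + v)

/-- The pairs `(a, b)` with `1 ≤ a < b ≤ n`; they index the pairs of positive roots
`e_a - e_b`, `e_a + e_b`. -/
def indexPairs (n : ℕ) : Finset (ℕ × ℕ) :=
  (Finset.Icc 1 n ×ˢ Finset.Icc 1 n).filter fun p => p.1 < p.2

theorem mem_indexPairs {p : ℕ × ℕ} : p ∈ indexPairs n ↔ 1 ≤ p.1 ∧ p.1 < p.2 ∧ p.2 ≤ n := by
  simp only [indexPairs, Finset.mem_filter, Finset.mem_product, Finset.mem_Icc]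
  omega

/-- The number of affine root hyperplanes that separate `x` from the fundamental alcove. -/
def sep (x : Fin n → ℝ) : ℕ := ∑ p ∈ indexPairs n, pairSep (coord x p.1) (coord x p.2)

theorem pairSep_neg_right (u v : ℝ) : pairSep u (-v) = pairSep u v := by
  rw [pairSep, pairSep, sub_neg_eq_add, add_comm, sub_eq_add_neg]

theorem pairSep_one_sub_left (u v : ℝ) : pairSep (1 - u) v = pairSep u v := by
  rw [pairSep, pairSep, show 1 - u - v = 1 - (u + v) by ring,
    show 1 - u + v = 1 - (u - v) by ring, crossings_one_sub, crossings_one_sub, add_comm]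

theorem pairSep_swap (u v : ℝ) :
    pairSep v u + crossings (u - v) = pairSep u v + crossings (-(u - v)) := by
  rw [pairSep, pairSep, neg_sub, add_comm v u]
  ring

theorem pairSep_neg_swap (u v : ℝ) :
    pairSep (-v) (-u) + crossings (u + v) = pairSep u v + crossings (-(u + v)) := by
  rw [pairSep, pairSep, show -v - -u = u - v by ring, show -v + -u = -(u + v) by ring]
  ring

theorem pairSep_one_sub_swap (u v : ℝ) :
    pairSep (1 - v) (1 - u) + crossings (1 - (u + v)) =
      pairSep u v + crossings (-(1 - (u + v))) := by
  rw [pairSep, pairSep, crossings_one_sub (u + v), ← crossings_one_sub (-(1 - (u + v))),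
    show 1 - v - (1 - u) = u - v by ring,
    show 1 - v + (1 - u) = 1 - -(1 - (u + v)) by ring]
  ring

theorem swap_mem_indexPairs {q a b : ℕ} (hq : 1 ≤ q) (hqn : q < n)
    (h : (a, b) ∈ (indexPairs n).erase (q, q + 1)) :
    (Equiv.swap q (q + 1) a, Equiv.swap q (q + 1) b) ∈ (indexPairs n).erase (q, q + 1) := by
  simp only [Finset.mem_erase, mem_indexPairs, ne_eq, Prod.mk.injEq, Equiv.swap_apply_def] at h ⊢
  grind

theorem sep_add_pairSep_of_swap {x y : Fin n → ℝ} {q : ℕ} (hq : 1 ≤ q) (hqn : q < n)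
    (h : ∀ a b, (a, b) ∈ (indexPairs n).erase (q, q + 1) →
      pairSep (coord y a) (coord y b) = pairSep (coord x (Equiv.swap q (q + 1) a))
        (coord x (Equiv.swap q (q + 1) b))) :
    sep y + pairSep (coord x q) (coord x (q + 1)) =
      sep x + pairSep (coord y q) (coord y (q + 1)) := by
  have hmem : (q, q + 1) ∈ indexPairs n := mem_indexPairs.2 ⟨hq, q.lt_succ_self, hqn⟩
  have hsum : ∑ p ∈ (indexPairs n).erase (q, q + 1), pairSep (coord y p.1) (coord y p.2) =
      ∑ p ∈ (indexPairs n).erase (q, q + 1), pairSep (coord x p.1) (coord x p.2) :=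
    Finset.sum_nbij' (Prod.map (Equiv.swap q (q + 1)) (Equiv.swap q (q + 1)))
      (Prod.map (Equiv.swap q (q + 1)) (Equiv.swap q (q + 1)))
      (fun _ => swap_mem_indexPairs hq hqn) (fun _ => swap_mem_indexPairs hq hqn)
      (fun _ _ => Prod.ext (Equiv.swap_apply_self ..) (Equiv.swap_apply_self ..))
      (fun _ _ => Prod.ext (Equiv.swap_apply_self ..) (Equiv.swap_apply_self ..))
      (fun p hp => h p.1 p.2 hp)
  rw [sep, sep, ← Finset.add_sum_erase _ _ hmem, ← Finset.add_sum_erase _ _ hmem, hsum]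
  ring

theorem sep_s_add_crossings (hn : 2 ≤ n) {j : ℕ} (hj : j ≤ n) (x : Fin n → ℝ) :
    sep (s n j x) + crossings (wall n j x) = sep x + crossings (-wall n j x) := by
  obtain rfl | hj0 := Nat.eq_zero_or_pos j
  · have hswap := sep_add_pairSep_of_swap (x := x) (y := s n 0 x) le_rfl hn fun a b hab => by
      simp only [Finset.mem_erase, mem_indexPairs, ne_eq, Prod.mk.injEq] at hab
      simp only [coord_s_zero hn, Equiv.swap_apply_def]
      grind [pairSep_one_sub_left]
    have hpair := pairSep_one_sub_swap (coord x 1) (coord x 2)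
    simp only [coord_s_zero hn, if_true, one_add_one_eq_two, OfNat.ofNat_ne_one, if_false] at hswap
    rw [wall_zero hn]
    omega
  obtain rfl | hjn := hj.eq_or_lt
  · obtain ⟨i, rfl⟩ : ∃ i, j = i + 1 := ⟨j - 1, by omega⟩
    have hswap := sep_add_pairSep_of_swap (q := i) (x := x) (y := s (i + 1) (i + 1) x) (by omega)
      i.lt_succ_self fun a b hab => by
        simp only [Finset.mem_erase, mem_indexPairs, ne_eq, Prod.mk.injEq] at hab
        simp only [coord_s_last hn, Equiv.swap_apply_def]
        grind [pairSep_neg_right]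
    have hpair := pairSep_neg_swap (coord x i) (coord x (i + 1))
    simp only [coord_s_last hn, if_true, i.succ_ne_self, if_false, Nat.add_sub_cancel] at hswap
    rw [wall_last hn, Nat.add_sub_cancel]
    omega
  · have hswap := sep_add_pairSep_of_swap (x := x) (y := s n j x) hj0 hjn fun a b hab => by
      simp only [Finset.mem_erase, mem_indexPairs, ne_eq, Prod.mk.injEq] at hab
      simp only [coord_s hj0 hjn, Equiv.swap_apply_def]
      grind
    have hpair := pairSep_swap (coord x j) (coord x (j + 1))
    simp only [coord_s hj0 hjn, if_true, j.succ_ne_self, if_false] at hswap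
    rw [wall_of_lt hj0 hjn]
    omega

theorem sep_s_of_wall_pos (hn : 2 ≤ n) {j : ℕ} (hj : j ≤ n) {x : Fin n → ℝ}
    (hx : 0 < wall n j x) : sep (s n j x) = sep x + 1 := by
  have := sep_s_add_crossings hn hj x
  rw [crossings_neg_of_pos hx] at this
  omega

theorem sep_s_of_wall_neg (hn : 2 ≤ n) {j : ℕ} (hj : j ≤ n) {x : Fin n → ℝ}
    (hx : wall n j x < 0) : sep x = sep (s n j x) + 1 := by
  have hpos : 0 < wall n j (s n j x) := by rwa [wall_s_self hn hj, neg_pos]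
  have := sep_s_of_wall_pos hn hj hpos
  rwa [← mul_apply, s_mul_self hn hj] at this

theorem sep_s_le (hn : 2 ≤ n) {j : ℕ} (hj : j ≤ n) (x : Fin n → ℝ) :
    sep (s n j x) ≤ sep x + 1 := by
  have := sep_s_add_crossings hn hj x
  have := crossings_neg_le (wall n j x)
  omega

theorem sep_wordProd_le (hn : 2 ≤ n) {L : List ℕ} (hL : ∀ j ∈ L, j ≤ n) (x : Fin n → ℝ) :
    sep (wordProd n L x) ≤ sep x + L.length := by
  induction L with
  | nil => exact le_rfl
  | cons j L ih =>
    have hle := ih fun i hi => hL i (List.mem_cons_of_mem _ hi)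
    have hstep := sep_s_le hn (hL j List.mem_cons_self) (wordProd n L x)
    rw [wordProd_cons, mul_apply, List.length_cons]
    omega

/-- The point `ρ / h` of the fundamental alcove, where `h = 2n - 2` is the Coxeter number. -/
def basePoint (n : ℕ) : Fin n → ℝ := fun a => ((n : ℝ) - ((a + 1 : ℕ) : ℝ)) / (2 * n - 2)

theorem coord_basePoint {k : ℕ} (h1 : 1 ≤ k) (h2 : k ≤ n) :
    coord (basePoint n) k = ((n : ℝ) - k) / (2 * n - 2) :=
  coord_of_fun (fun k => ((n : ℝ) - k) / (2 * n - 2)) h1 h2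

theorem coord_basePoint_sub_mem_Ioo {a b : ℕ} (ha : 1 ≤ a) (hab : a < b) (hb : b ≤ n) :
    coord (basePoint n) a - coord (basePoint n) b ∈ Set.Ioo 0 1 := by
  have ha' : (1 : ℝ) ≤ a := by exact_mod_cast ha
  have hab' : (a : ℝ) + 1 ≤ b := by exact_mod_cast hab
  have hb' : (b : ℝ) ≤ n := by exact_mod_cast hb
  have hpos : (0 : ℝ) < 2 * n - 2 := by linarith
  rw [coord_basePoint ha (by omega), coord_basePoint (by omega) hb, ← sub_div, Set.mem_Ioo,
    lt_div_iff₀ hpos, div_lt_iff₀ hpos]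
  constructor <;> linarith

theorem coord_basePoint_add_mem_Ioo {a b : ℕ} (ha : 1 ≤ a) (hab : a < b) (hb : b ≤ n) :
    coord (basePoint n) a + coord (basePoint n) b ∈ Set.Ioo 0 1 := by
  have ha' : (1 : ℝ) ≤ a := by exact_mod_cast ha
  have hab' : (a : ℝ) + 1 ≤ b := by exact_mod_cast hab
  have hb' : (b : ℝ) ≤ n := by exact_mod_cast hb
  have hpos : (0 : ℝ) < 2 * n - 2 := by linarith
  rw [coord_basePoint ha (by omega), coord_basePoint (by omega) hb, ← add_div, Set.mem_Ioo,
    lt_div_iff₀ hpos, div_lt_iff₀ hpos]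
  constructor <;> linarith

theorem pairSep_basePoint_sub {v : Fin n → ℝ} {a b k l : ℕ} (ha : 1 ≤ a) (hab : a < b)
    (hb : b ≤ n) (hk : coord v a - coord v b = k) (hl : coord v a + coord v b = l) :
    pairSep (coord (basePoint n - v) a) (coord (basePoint n - v) b) = k + l := by
  have hsub := coord_basePoint_sub_mem_Ioo ha hab hb
  have hadd := coord_basePoint_add_mem_Ioo ha hab hb
  rw [pairSep, coord_sub, coord_sub, sub_sub_sub_comm, sub_add_sub_comm, hk, hl,
    crossings_sub_natCast hsub.1 hsub.2, crossings_sub_natCast hadd.1 hadd.2]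

theorem sep_basePoint_sub {v : Fin n → ℝ} (hv : ∀ a b, 1 ≤ a → a < b → b ≤ n →
      ∃ k l : ℕ, coord v a - coord v b = k ∧ coord v a + coord v b = l) :
    (sep (basePoint n - v) : ℝ) = ∑ a ∈ Finset.Icc 1 n, 2 * ((n : ℝ) - a) * coord v a := by
  have hpair : ∀ p ∈ indexPairs n, (pairSep (coord (basePoint n - v) p.1)
      (coord (basePoint n - v) p.2) : ℝ) = 2 * coord v p.1 := by
    rintro ⟨a, b⟩ hp
    obtain ⟨ha, hab, hb⟩ := mem_indexPairs.1 hp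
    obtain ⟨k, l, hk, hl⟩ := hv a b ha hab hb
    rw [pairSep_basePoint_sub ha hab hb hk hl, Nat.cast_add, ← hk, ← hl]
    ring
  rw [sep, Nat.cast_sum, Finset.sum_congr rfl hpair, Finset.sum_finset_product (indexPairs n)
    (Finset.Icc 1 n) (fun a => Finset.Ioc a n) fun p => by
      rw [mem_indexPairs, Finset.mem_Icc, Finset.mem_Ioc]; omega]
  refine Finset.sum_congr rfl fun a ha => ?_
  dsimp only
  rw [Finset.sum_const, Nat.card_Ioc, nsmul_eq_mul, Nat.cast_sub (Finset.mem_Icc.1 ha).2]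
  ring

theorem sep_basePoint : sep (basePoint n) = 0 := by
  have hzero : ∀ k, coord (0 : Fin n → ℝ) k = 0 := fun k => by simp [coord]
  have := sep_basePoint_sub (n := n) (v := 0) fun a b _ _ _ => ⟨0, 0, by simp [hzero]⟩
  simpa [hzero] using this

theorem wall_basePoint (hn : 2 ≤ n) {j : ℕ} (hj : j ≤ n) :
    wall n j (basePoint n) = 1 / (2 * n - 2) := by
  have hn' : (2 : ℝ) ≤ n := by exact_mod_cast hn
  have hne : (2 * n - 2 : ℝ) ≠ 0 := by linarith
  obtain rfl | hj0 := Nat.eq_zero_or_pos j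
  · rw [wall_zero hn, coord_basePoint le_rfl (by omega), coord_basePoint (by omega) hn, ← add_div,
      eq_div_iff hne, sub_mul, div_mul_cancel₀ _ hne]
    push_cast
    ring
  obtain rfl | hjn := hj.eq_or_lt
  · rw [wall_last hn, coord_basePoint (by omega) (by omega), coord_basePoint (by omega) le_rfl,
      Nat.cast_sub (by omega)]
    push_cast
    ring
  · rw [wall_of_lt hj0 hjn, coord_basePoint hj0 hj, coord_basePoint (by omega) hjn]
    push_cast
    ring

theorem wall_basePoint_pos (hn : 2 ≤ n) {j : ℕ} (hj : j ≤ n) : 0 < wall n j (basePoint n) := by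
  have hn' : (2 : ℝ) ≤ n := by exact_mod_cast hn
  rw [wall_basePoint hn hj]
  exact one_div_pos.2 (by linarith)

theorem coord_antitone_of_wall_nonneg {x : Fin n → ℝ}
    (hx : ∀ j, 1 ≤ j → j < n → 0 ≤ wall n j x) {a b : ℕ} (ha : 1 ≤ a) (hab : a ≤ b) (hb : b ≤ n) :
    coord x b ≤ coord x a := by
  induction b, hab using Nat.le_induction with
  | base => exact le_rfl
  | succ b hab ih =>
    have hwall := hx b (by omega) (by omega)
    rw [wall_of_lt (by omega) (by omega)] at hwall
    linarith [ih (by omega)]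

-- With `d = ρ / h - y` the hypotheses give `d_1 ≥ ⋯ ≥ d_n`, `d_{n-1} + d_n ≥ 0` and
-- `d_1 + d_2 ≤ 0`.
theorem eq_basePoint_of_wall_le (hn : 4 ≤ n) {y : Fin n → ℝ}
    (hy : ∀ j ≤ n, wall n j y ≤ wall n j (basePoint n)) : y = basePoint n := by
  have hanti {a b : ℕ} := coord_antitone_of_wall_nonneg (x := basePoint n - y)
    (fun j hj hjn => by
      have := hy j hjn.le
      rw [wall_of_lt hj hjn, wall_of_lt hj hjn] at this
      rw [wall_of_lt hj hjn, coord_sub, coord_sub]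
      linarith) (a := a) (b := b)
  have hfirst := hy 0 n.zero_le
  have hlast := hy n le_rfl
  simp only [wall_zero (show 2 ≤ n by omega), wall_last (show 2 ≤ n by omega)] at hfirst hlast
  simp only [coord_sub] at hanti
  refine coord_ext fun k hk hkn => ?_
  linarith [hanti le_rfl one_le_two (by omega), hanti (a := 2) (b := n - 1) (by omega) (by omega)
    (by omega), hanti (a := n - 1) (b := n) (by omega) (by omega) le_rfl,
    hanti le_rfl hk hkn, hanti hk hkn le_rfl]

/-- The affine transformations whose linear part preserves the scalar product. -/
def isometryGroup (n : ℕ) : Subgroup (AffineGroup n) where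
  carrier := {g | ∀ v w, g.linear v ⬝ᵥ g.linear w = v ⬝ᵥ w}
  mul_mem' {_ _} hg hh _ _ := (hg _ _).trans (hh _ _)
  one_mem' _ _ := rfl
  inv_mem' {g} hg v w := by
    have h := hg (g.linear.symm v) (g.linear.symm w)
    rw [LinearEquiv.apply_symm_apply, LinearEquiv.apply_symm_apply] at h
    exact h.symm

theorem apply_add (g : AffineGroup n) (x v : Fin n → ℝ) : g (x + v) = g x + g.linear v := by
  rw [add_comm x, add_comm (g x)]
  exact g.map_vadd x v

theorem linear_sub (g : AffineGroup n) (x y : Fin n → ℝ) : g.linear (x - y) = g x - g y :=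
  eq_sub_of_add_eq' (by rw [← apply_add, add_sub_cancel])

theorem refl_mem_isometryGroup (v : Fin n → ℝ) : refl n v ∈ isometryGroup n := by
  intro x y
  change (x - (2 * (v ⬝ᵥ x) / (v ⬝ᵥ v)) • v) ⬝ᵥ (y - (2 * (v ⬝ᵥ y) / (v ⬝ᵥ v)) • v) = x ⬝ᵥ y
  by_cases hv : v ⬝ᵥ v = 0
  · simp [hv]
  · simp only [dotProduct_sub, sub_dotProduct, dotProduct_smul, smul_dotProduct, smul_eq_mul,
      dotProduct_comm x v]
    field_simp
    ring

theorem extAffineWeyl_le_isometryGroup : extAffineWeyl n ≤ isometryGroup n := by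
  refine sup_le ((Subgroup.closure_le _).2 ?_) ((Subgroup.closure_le _).2 ?_)
  · rintro _ ⟨j, hj, rfl⟩
    rw [s, if_neg (by have := hj.1; omega)]
    exact refl_mem_isometryGroup _
  · rintro _ ⟨v, -, rfl⟩ x y
    rfl

theorem s_sub_self_dot (hn : 2 ≤ n) {j : ℕ} (hj : j ≤ n) (x : Fin n → ℝ) :
    (s n j x - x) ⬝ᵥ (s n j x - x) = 2 * wall n j x ^ 2 := by
  rw [s_apply hn hj, sub_sub_cancel_left, neg_dotProduct_neg, dotProduct_smul, smul_dotProduct,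
    wallNormal_dot_self hn hj, smul_eq_mul, smul_eq_mul]
  ring

/-- An element of `Λ` permutes the walls of the fundamental alcove, and `ρ / h` is the only point of
this alcove equidistant from all of them. -/
theorem diagramGroup_apply_basePoint (hn : 4 ≤ n) {lam : AffineGroup n}
    (hlam : lam ∈ diagramGroup n) : lam (basePoint n) = basePoint n := by
  have hn2 : 2 ≤ n := by omega
  refine eq_basePoint_of_wall_le hn fun j hj => ?_
  obtain ⟨k, ⟨-, hk⟩, hkj⟩ : lam⁻¹ * s n j * lam ∈ simpleReflections n := by
    have := (Subgroup.mem_set_normalizer_iff.1 (inv_mem (Subgroup.mem_inf.1 hlam).2) (s n j)).1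
      ⟨j, ⟨j.zero_le, hj⟩, rfl⟩
    rwa [inv_inv] at this
  have hconj : lam (s n k (basePoint n)) = s n j (lam (basePoint n)) := by
    rw [← mul_apply, ← mul_apply, hkj]
    congr 1
    group
  have hsq : wall n j (lam (basePoint n)) ^ 2 = wall n j (basePoint n) ^ 2 := by
    have := extAffineWeyl_le_isometryGroup hlam.1 (s n k (basePoint n) - basePoint n)
      (s n k (basePoint n) - basePoint n)
    rw [linear_sub, hconj, s_sub_self_dot hn2 hj, s_sub_self_dot hn2 hk, wall_basePoint hn2 hk,
      ← wall_basePoint hn2 hj] at this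
    linarith
  exact (abs_le_of_sq_le_sq' hsq.le (wall_basePoint_pos hn2 hj).le).2

theorem mul_s_eq_s_mul_of_wall (hn : 2 ≤ n) {g : AffineGroup n} (hg : g ∈ isometryGroup n) {k l : ℕ}
    (hk : k ≤ n) (hl : l ≤ n) (hwall : ∀ x, wall n l (g x) = wall n k x) :
    g * s n k = s n l * g := by
  have hnormal : g.linear (wallNormal n k) = wallNormal n l := by
    refine dotProduct_eq _ _ fun w => ?_
    obtain ⟨v, rfl⟩ := g.linear.surjective w
    have := hwall (0 + v)
    rw [apply_add, wall_add, wall_add, hwall 0, add_right_inj] at this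
    rw [hg, this]
  ext1 x
  rw [mul_apply, mul_apply, s_apply hn hk, s_apply hn hl, hwall, ← hnormal, ← map_smul,
    sub_eq_add_neg, apply_add, map_neg, sub_eq_add_neg]

theorem mem_diagramGroup_of_wall (hn : 2 ≤ n) {g : AffineGroup n} (hg : g ∈ extAffineWeyl n)
    (hwall : ∀ k ≤ n, ∃ l ≤ n, ∀ x, wall n l (g x) = wall n k x) : g ∈ diagramGroup n := by
  refine Subgroup.mem_inf.2 ⟨hg, ?_⟩
  have hmaps : (fun h => g * h * g⁻¹) '' simpleReflections n ⊆ simpleReflections n := by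
    rintro _ ⟨_, ⟨k, ⟨-, hk⟩, rfl⟩, rfl⟩
    obtain ⟨l, hl, hkl⟩ := hwall k hk
    refine ⟨l, ⟨l.zero_le, hl⟩, ?_⟩
    dsimp only
    rw [mul_s_eq_s_mul_of_wall hn (extAffineWeyl_le_isometryGroup hg) hk hl hkl,
      mul_inv_cancel_right]
  have hinj : Function.Injective fun h => g * h * g⁻¹ := (MulAut.conj g).injective
  have hsurj := Set.eq_of_subset_of_ncard_le hmaps (Set.ncard_image_of_injective _ hinj).ge
    ((Set.finite_Icc 0 n).image _)
  refine Subgroup.mem_set_normalizer_iff.2 fun h => ?_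
  rw [← hinj.mem_set_image (s := simpleReflections n), hsurj]

theorem wordProd_inv (hn : 2 ≤ n) {L : List ℕ} (hL : ∀ j ∈ L, j ≤ n) :
    (wordProd n L)⁻¹ = wordProd n L.reverse := by
  induction L with
  | nil => exact inv_one
  | cons j L ih =>
    rw [List.reverse_cons, wordProd_append, wordProd_singleton, wordProd_cons, mul_inv_rev,
      ih fun i hi => hL i (List.mem_cons_of_mem _ hi),
      inv_eq_of_mul_eq_one_left (s_mul_self hn (hL j List.mem_cons_self))]

theorem sep_le_of_expression (hn : 4 ≤ n) {v : Fin n → ℝ} {lam : AffineGroup n} {L : List ℕ}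
    (hlam : lam ∈ diagramGroup n) (hL : ∀ j ∈ L, j ≤ n)
    (h : translation n v = lam * wordProd n L) : sep (basePoint n - v) ≤ L.length := by
  have hsub : basePoint n - v = wordProd n L.reverse (basePoint n) := by
    apply (translation n v).injective
    rw [← wordProd_inv (by omega) hL, translation_apply, add_sub_cancel, h, ← mul_apply,
      mul_inv_cancel_right, diagramGroup_apply_basePoint hn hlam]
  have hle := sep_wordProd_le (show 2 ≤ n by omega) (L := L.reverse)
    (fun j hj => hL j (List.mem_reverse.1 hj)) (basePoint n)
  rwa [← hsub, sep_basePoint, zero_add, List.length_reverse] at hle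

theorem isReducedExpression_translation (hn : 4 ≤ n) {v : Fin n → ℝ} {lam : AffineGroup n}
    {L : List ℕ} (hlam : lam ∈ diagramGroup n) (hL : ∀ j ∈ L, j ≤ n)
    (h : translation n v = lam * wordProd n L) (hlen : L.length = sep (basePoint n - v)) :
    IsReducedExpression n (translation n v) lam L := by
  refine ⟨hlam, hL, h, ?_⟩
  have hmem : L.length ∈ {r | ∃ lam ∈ diagramGroup n, ∃ L : List ℕ,
      (∀ j ∈ L, j ≤ n) ∧ L.length = r ∧ translation n v = lam * wordProd n L} :=
    ⟨lam, hlam, L, hL, rfl, h⟩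
  obtain ⟨lam', hlam', L', hL', hlen', h'⟩ := Nat.sInf_mem ⟨_, hmem⟩
  refine le_antisymm ?_ (Nat.sInf_le hmem)
  rw [extLength, ← hlen', hlen]
  exact sep_le_of_expression hn hlam' hL' h'

/-- The signed permutation `x ↦ (ε_1 x_{σ(1)}, …, ε_n x_{σ(n)})`. -/
def signedPerm (σ : Equiv.Perm (Fin n)) (ε : Fin n → ℤˣ) : AffineGroup n :=
  ((LinearEquiv.funCongrLeft ℝ ℝ σ).trans
    (LinearEquiv.piCongrRight fun a => DistribMulAction.toLinearEquiv ℝ ℝ (ε a))).toAffineEquiv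

theorem signedPerm_apply (σ : Equiv.Perm (Fin n)) (ε : Fin n → ℤˣ) (x : Fin n → ℝ) (a : Fin n) :
    signedPerm σ ε x a = ε a • x (σ a) := rfl

theorem signedPerm_mul (σ τ : Equiv.Perm (Fin n)) (ε δ : Fin n → ℤˣ) :
    signedPerm σ ε * signedPerm τ δ = signedPerm (τ * σ) fun a => ε a * δ (σ a) := by
  ext x a
  simp only [mul_apply, signedPerm_apply, smul_smul, Equiv.Perm.mul_apply]

theorem signedPerm_one : signedPerm (1 : Equiv.Perm (Fin n)) (fun _ => 1) = 1 := by
  ext x a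
  rw [signedPerm_apply, one_smul]
  rfl

/-- The signed permutations with an even number of signs, that is, the Weyl group of type `D_n`. -/
def evenSignedGroup (n : ℕ) : Subgroup (AffineGroup n) where
  carrier := {g | ∃ (σ : Equiv.Perm (Fin n)) (ε : Fin n → ℤˣ), ∏ a, ε a = 1 ∧ g = signedPerm σ ε}
  mul_mem' := by
    rintro _ _ ⟨σ, ε, hε, rfl⟩ ⟨τ, δ, hδ, rfl⟩
    refine ⟨_, _, ?_, signedPerm_mul σ τ ε δ⟩
    rw [Finset.prod_mul_distrib, hε, Equiv.prod_comp σ δ, hδ, one_mul]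
  one_mem' := ⟨1, fun _ => 1, Finset.prod_const_one, signedPerm_one.symm⟩
  inv_mem' := by
    rintro _ ⟨σ, ε, hε, rfl⟩
    refine ⟨σ⁻¹, fun a => ε (σ⁻¹ a), (Equiv.prod_comp σ⁻¹ ε).trans hε, ?_⟩
    refine inv_eq_of_mul_eq_one_right ?_
    rw [signedPerm_mul, inv_mul_cancel]
    simp only [Equiv.Perm.inv_def, Equiv.symm_apply_apply, Int.units_mul_self, signedPerm_one]

theorem finite_evenSignedGroup : (evenSignedGroup n : Set (AffineGroup n)).Finite :=
  (Set.finite_range fun p : Equiv.Perm (Fin n) × (Fin n → ℤˣ) => signedPerm p.1 p.2).subset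
    fun _ ⟨σ, ε, _, h⟩ => ⟨(σ, ε), h.symm⟩

theorem linear_apply_of_mem_evenSignedGroup {g : AffineGroup n} (hg : g ∈ evenSignedGroup n)
    (v : Fin n → ℝ) : g.linear v = g v := by
  obtain ⟨σ, ε, -, rfl⟩ := hg
  rfl

theorem s_mem_evenSignedGroup (hn : 2 ≤ n) {j : ℕ} (hj : j ∈ Set.Icc 1 n) :
    s n j ∈ evenSignedGroup n := by
  obtain ⟨hj1, hjn⟩ := hj
  obtain hjn | hjn := hjn.eq_or_lt
  · let a : Fin n := ⟨n - 2, by omega⟩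
    let b : Fin n := ⟨n - 1, by omega⟩
    have hab : a ≠ b := fun h => by simp only [a, b, Fin.mk.injEq] at h; omega
    refine ⟨Equiv.swap a b, Pi.mulSingle a (-1) * Pi.mulSingle b (-1), ?_, ?_⟩
    · simp only [Pi.mul_apply, Finset.prod_mul_distrib, Fintype.prod_pi_mulSingle']
      rfl
    · ext x c
      have hsigned : signedPerm (Equiv.swap a b) (Pi.mulSingle a (-1) * Pi.mulSingle b (-1)) x c =
          if c = a then -x b else if c = b then -x a else x c := by
        rw [signedPerm_apply, Pi.mul_apply, Pi.mulSingle_apply, Pi.mulSingle_apply,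
          Equiv.swap_apply_def]
        split_ifs <;> simp_all [Units.smul_def]
      rw [hsigned, apply_eq_coord (s n j x), hjn, coord_s_last hn, apply_eq_coord x a,
        apply_eq_coord x b, apply_eq_coord x c]
      simp only [a, b, Fin.ext_iff]
      grind
  · refine ⟨Equiv.swap ⟨j - 1, by omega⟩ ⟨j, hjn⟩, fun _ => 1, Finset.prod_const_one, ?_⟩
    ext x c
    rw [apply_eq_coord (s n j x), coord_s hj1 hjn, signedPerm_apply, one_smul,
      Equiv.swap_apply_def, apply_eq_coord x]
    simp only [Fin.ext_iff]
    grind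

theorem abs_coord_le_of_wall_nonneg (hn : 2 ≤ n) {x : Fin n → ℝ}
    (hx : ∀ j ∈ Set.Icc 1 n, 0 ≤ wall n j x) {a b : ℕ} (ha : 1 ≤ a) (hab : a < b) (hb : b ≤ n) :
    |coord x b| ≤ coord x a := by
  have hanti {p q : ℕ} := coord_antitone_of_wall_nonneg (fun j h1 h2 => hx j ⟨h1, h2.le⟩)
    (a := p) (b := q)
  have hlast := hx n ⟨by omega, le_rfl⟩
  rw [wall_last hn] at hlast
  rw [abs_le]
  constructor
  · linarith [hanti (show 1 ≤ b by omega) hb le_rfl,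
      hanti ha (show a ≤ n - 1 by omega) (by omega)]
  · exact hanti ha hab.le hb

theorem abs_coord_lt_of_wall_pos (hn : 2 ≤ n) {x : Fin n → ℝ}
    (hx : ∀ j ∈ Set.Icc 1 n, 0 < wall n j x) {a b : ℕ} (ha : 1 ≤ a) (hab : a < b) (hb : b ≤ n) :
    |coord x b| < coord x a := by
  have hanti {p q : ℕ} := coord_antitone_of_wall_nonneg (fun j h1 h2 => (hx j ⟨h1, h2.le⟩).le)
    (a := p) (b := q)
  have hlast := hx n ⟨by omega, le_rfl⟩
  have hwall := hx a ⟨ha, by omega⟩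
  rw [wall_last hn] at hlast
  rw [wall_of_lt ha (by omega)] at hwall
  rw [abs_lt]
  constructor
  · linarith [hanti (show 1 ≤ b by omega) hb le_rfl,
      hanti ha (show a ≤ n - 1 by omega) (by omega)]
  · linarith [hanti (show 1 ≤ a + 1 by omega) hab hb]

theorem abs_units_smul (δ : ℤˣ) (t : ℝ) : |δ • t| = |t| := by
  obtain rfl | rfl := Int.units_eq_one_or δ <;> simp [Units.smul_def]

/-- The Weyl group acts freely on the interior of the dominant chamber: comparing absolute values
shows that the permutation is monotone, and then comparing signs leaves at most the last one. -/
theorem eq_one_of_wall_pos_of_wall_nonneg (hn : 2 ≤ n) {g : AffineGroup n}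
    (hg : g ∈ evenSignedGroup n) {x : Fin n → ℝ} (hx : ∀ j ∈ Set.Icc 1 n, 0 < wall n j x)
    (hgx : ∀ j ∈ Set.Icc 1 n, 0 ≤ wall n j (g x)) : g = 1 := by
  obtain ⟨σ, ε, hε, rfl⟩ := hg
  have habs_lt : ∀ a b : Fin n, a < b → |x b| < x a := fun a b hab => by
    rw [apply_eq_coord x a, apply_eq_coord x b]
    exact abs_coord_lt_of_wall_pos hn hx (by omega) (by omega) (by omega)
  have habs_le : ∀ a b : Fin n, a < b → |ε b • x (σ b)| ≤ ε a • x (σ a) := fun a b hab => by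
    rw [← signedPerm_apply, ← signedPerm_apply, apply_eq_coord (signedPerm σ ε x),
      apply_eq_coord (signedPerm σ ε x)]
    exact abs_coord_le_of_wall_nonneg hn hgx (by omega) (by omega) (by omega)
  have hanti : StrictAnti fun a => |x a| := fun a b hab =>
    (habs_lt a b hab).trans_le (le_abs_self _)
  have hmono : StrictMono σ := Monotone.strictMono_of_injective
    (monotone_iff_forall_lt.2 fun a b hab => hanti.le_iff_ge.1 <| by
      have := (habs_le a b hab).trans (le_abs_self _)
      rwa [abs_units_smul, abs_units_smul] at this) σ.injective
  obtain rfl : σ = 1 := Equiv.ext (congrFun ((hmono.range_inj strictMono_id).1 (by simp)))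
  have hinit : ∀ a b : Fin n, a < b → ε a = 1 := fun a b hab => by
    have hpos := (abs_nonneg _).trans_lt (habs_lt a b hab)
    have hnonneg := (abs_nonneg _).trans (habs_le a b hab)
    refine (Int.units_eq_one_or (ε a)).resolve_right fun h => ?_
    rw [h, Units.neg_smul, one_smul, Equiv.Perm.one_apply] at hnonneg
    linarith
  let last : Fin n := ⟨n - 1, by omega⟩
  have hlt : ∀ a ≠ last, a < last := fun a ha =>
    lt_of_le_of_ne (by simp [last, Fin.le_def]; omega) ha
  have hlast : ε last = 1 := by
    rwa [Finset.prod_eq_single last (fun a _ ha => hinit a last (hlt a ha)) (by simp)] at hε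
  obtain rfl : ε = fun _ => 1 := funext fun a => by
    by_cases ha : a = last
    · rw [ha, hlast]
    · exact hinit a last (hlt a ha)
  exact signedPerm_one

section Parabolic

variable {I : Set ℕ}

theorem wall_fundamentalWeight (hn : 4 ≤ n) {i j : ℕ} (hi : i ∈ Set.Icc 1 n) (hj : j ≤ n) :
    wall n i (fundamentalWeight n j) = if j = i then 1 else 0 := by
  rw [wall_eq_simpleRoot_dot hi.1, simpleRoot_dot_fundamentalWeight n j i hn hj hi.1 hi.2]

theorem mem_evenSignedGroup_of_mem_closure (hn : 2 ≤ n) (hI : I ⊆ Set.Icc 1 n) {w : AffineGroup n}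
    (hw : w ∈ Subgroup.closure (s n '' I)) : w ∈ evenSignedGroup n :=
  (Subgroup.closure_le _).2 (Set.image_subset_iff.2 fun _ hi => s_mem_evenSignedGroup hn (hI hi)) hw

theorem apply_fundamentalWeight_of_mem_closure (hn : 4 ≤ n) (hI : I ⊆ Set.Icc 1 n) {j : ℕ}
    (hj : j ∈ Set.Icc 1 n \ I) {w : AffineGroup n} (hw : w ∈ Subgroup.closure (s n '' I)) :
    w (fundamentalWeight n j) = fundamentalWeight n j := by
  induction hw using Subgroup.closure_induction with
  | mem _ hs =>
    obtain ⟨i, hi, rfl⟩ := hs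
    have hji : j ≠ i := fun h => hj.2 (h ▸ hi)
    rw [s_apply (by omega) (hI hi).2, wall_fundamentalWeight hn (hI hi) hj.1.2,
      if_neg hji, zero_smul, sub_zero]
  | one => rfl
  | mul g h _ _ hg hh => rw [mul_apply, hh, hg]
  | inv g _ hg => exact (AffineEquiv.symm_apply_eq g).2 hg.symm

/-- Adding to `ρ / h` a large multiple of the sum of the fixed fundamental weights reduces this to
the freeness of the action on the interior of the dominant chamber. -/
theorem eq_one_of_wall_nonneg_of_apply_fundamentalWeight (hn : 4 ≤ n) {g : AffineGroup n}
    (hg : g ∈ evenSignedGroup n)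
    (hfix : ∀ j ∈ Set.Icc 1 n \ I, g (fundamentalWeight n j) = fundamentalWeight n j)
    (hpos : ∀ i ∈ I, 0 ≤ wall n i (g (basePoint n))) : g = 1 := by
  classical
  let J := (Finset.Icc 1 n).filter (· ∉ I)
  let v := ∑ j ∈ J, fundamentalWeight n j
  let M := ∑ i ∈ Finset.Icc 1 n, |wall n i (g (basePoint n))|
  have hM : 0 ≤ M := Finset.sum_nonneg fun _ _ => abs_nonneg _
  have hgv : g.linear v = v := by
    rw [map_sum]
    refine Finset.sum_congr rfl fun j hj => ?_
    obtain ⟨hj, hjI⟩ := Finset.mem_filter.1 hj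
    rw [linear_apply_of_mem_evenSignedGroup hg, hfix j ⟨Finset.mem_Icc.1 hj, hjI⟩]
  have hwall_v : ∀ i ∈ Set.Icc 1 n, wallNormal n i ⬝ᵥ v = if i ∈ I then 0 else 1 := fun i hi => by
    have hsum : ∀ j ∈ J, wallNormal n i ⬝ᵥ fundamentalWeight n j = if j = i then 1 else 0 := by
      intro j hj
      rw [wallNormal, if_neg (by grind), simpleRoot_dot_fundamentalWeight n j i hn
        (Finset.mem_Icc.1 (Finset.mem_filter.1 hj).1).2 hi.1 hi.2]
    rw [dotProduct_sum, Finset.sum_congr rfl hsum, Finset.sum_ite_eq']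
    simp only [J, Finset.mem_filter, Finset.mem_Icc, Set.mem_Icc.1 hi, true_and, ite_not]
  refine eq_one_of_wall_pos_of_wall_nonneg (by omega) hg (x := basePoint n + M • v)
    (fun i hi => ?_) (fun i hi => ?_)
  · have hb := wall_basePoint_pos (show 2 ≤ n by omega) hi.2
    rw [wall_add, dotProduct_smul, hwall_v i hi, smul_eq_mul]
    split_ifs <;> linarith
  · rw [apply_add, map_smul, hgv, wall_add, dotProduct_smul, hwall_v i hi, smul_eq_mul]
    split_ifs with hiI
    · linarith [hpos i hiI]
    · have hle : |wall n i (g (basePoint n))| ≤ M := Finset.single_le_sum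
        (f := fun i => |wall n i (g (basePoint n))|) (fun _ _ => abs_nonneg _) (Finset.mem_Icc.2 hi)
      linarith [neg_abs_le (wall n i (g (basePoint n)))]

theorem exists_word_length_eq_sep (hn : 4 ≤ n) (hI : I ⊆ Set.Icc 1 n) {w : AffineGroup n}
    (hw : w ∈ Subgroup.closure (s n '' I)) :
    ∃ L : List ℕ, (∀ i ∈ L, i ∈ I) ∧ L.length = sep (w (basePoint n)) ∧ w = wordProd n L := by
  have hn2 : 2 ≤ n := by omega
  induction hk : sep (w (basePoint n)) using Nat.strong_induction_on generalizing w with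
  | _ k ih =>
  subst hk
  by_cases hpos : ∀ i ∈ I, 0 ≤ wall n i (w (basePoint n))
  · obtain rfl := eq_one_of_wall_nonneg_of_apply_fundamentalWeight hn
      (mem_evenSignedGroup_of_mem_closure hn2 hI hw)
      (fun j hj => apply_fundamentalWeight_of_mem_closure hn hI hj hw) hpos
    exact ⟨[], by simp, sep_basePoint.symm, rfl⟩
  · push Not at hpos
    obtain ⟨i, hi, hneg⟩ := hpos
    have hsep := sep_s_of_wall_neg hn2 (hI hi).2 hneg
    obtain ⟨L, hL, hlen, hwL⟩ := ih _ (by rw [mul_apply]; omega)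
      (mul_mem (Subgroup.subset_closure (Set.mem_image_of_mem _ hi)) hw) rfl
    refine ⟨i :: L, by simpa [hi] using hL, by rw [List.length_cons, hlen, hsep, mul_apply], ?_⟩
    rw [wordProd_cons, ← hwL, ← mul_assoc, s_mul_self hn2 (hI hi).2, one_mul]

theorem parabolicLength_eq_sep (hn : 4 ≤ n) (hI : I ⊆ Set.Icc 1 n) {w : AffineGroup n}
    (hw : w ∈ Subgroup.closure (s n '' I)) : parabolicLength n I w = sep (w (basePoint n)) := by
  obtain ⟨L, hL, hlen, hwL⟩ := exists_word_length_eq_sep hn hI hw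
  have hmem : L.length ∈ {r | ∃ L : List ℕ, (∀ i ∈ L, i ∈ I) ∧ L.length = r ∧ w = wordProd n L} :=
    ⟨L, hL, rfl, hwL⟩
  refine le_antisymm (hlen ▸ Nat.sInf_le hmem) ?_
  obtain ⟨L', hL', hlen', hwL'⟩ := Nat.sInf_mem ⟨_, hmem⟩
  have hle := sep_wordProd_le (show 2 ≤ n by omega) (fun i hi => (hI (hL' i hi)).2) (basePoint n)
  rwa [sep_basePoint, zero_add, ← hwL', hlen'] at hle

theorem isLongest_longest (hn : 2 ≤ n) (hI : I ⊆ Set.Icc 1 n) : IsLongest n I (longest n I) := by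
  have hfin : (Subgroup.closure (s n '' I) : Set (AffineGroup n)).Finite :=
    finite_evenSignedGroup.subset fun _ => mem_evenSignedGroup_of_mem_closure hn hI
  obtain ⟨w, hw, hmax⟩ := Set.exists_max_image _ (parabolicLength n I) hfin ⟨1, one_mem _⟩
  exact Classical.epsilon_spec (p := IsLongest n I) ⟨w, hw, hmax⟩

theorem wall_longest_basePoint_nonpos (hn : 4 ≤ n) (hI : I ⊆ Set.Icc 1 n) {i : ℕ} (hi : i ∈ I) :
    wall n i (longest n I (basePoint n)) ≤ 0 := by
  obtain ⟨hw, hmax⟩ := isLongest_longest (show 2 ≤ n by omega) hI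
  by_contra! hpos
  have hsw := mul_mem (Subgroup.subset_closure (Set.mem_image_of_mem (s n) hi)) hw
  have hle := hmax _ hsw
  rw [parabolicLength_eq_sep hn hI hsw, parabolicLength_eq_sep hn hI hw, mul_apply,
    sep_s_of_wall_pos (by omega) (hI hi).2 hpos] at hle
  omega

theorem longest_eq (hn : 4 ≤ n) (hI : I ⊆ Set.Icc 1 n) {u : AffineGroup n}
    (hu : u ∈ evenSignedGroup n) (huu : u * u = 1)
    (hfix : ∀ j ∈ Set.Icc 1 n \ I, u (fundamentalWeight n j) = fundamentalWeight n j)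
    (hneg : ∀ x, (∀ i ∈ I, wall n i x ≤ 0) → ∀ i ∈ I, 0 ≤ wall n i (u x)) : longest n I = u := by
  have hw := (isLongest_longest (show 2 ≤ n by omega) hI).1
  have hone : u * longest n I = 1 := by
    refine eq_one_of_wall_nonneg_of_apply_fundamentalWeight hn
      (mul_mem hu (mem_evenSignedGroup_of_mem_closure (by omega) hI hw)) (fun j hj => ?_)
      (hneg _ fun i => wall_longest_basePoint_nonpos hn hI)
    rw [mul_apply, apply_fundamentalWeight_of_mem_closure hn hI hj hw, hfix j hj]
  exact mul_left_cancel (hone.trans huu.symm)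

end Parabolic

section SignedPerm

variable {σ : Equiv.Perm (Fin n)} {ε : Fin n → ℤˣ}

theorem coord_signedPerm (x : Fin n → ℝ) {k : ℕ} (hk : 1 ≤ k) (hkn : k - 1 < n) :
    coord (signedPerm σ ε x) k = ((ε ⟨k - 1, hkn⟩ : ℤ) : ℝ) * coord x (σ ⟨k - 1, hkn⟩ + 1) := by
  rw [← apply_eq_coord, coord, dif_pos ⟨hk, by omega⟩, signedPerm_apply, Units.smul_def,
    zsmul_eq_mul]

theorem signedPerm_mul_self (hσ : σ * σ = 1) (hε : ∀ a, ε (σ a) = ε a) :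
    signedPerm σ ε * signedPerm σ ε = 1 := by
  simp only [signedPerm_mul, hσ, hε, Int.units_mul_self, signedPerm_one]

end SignedPerm

theorem wall_nonneg_of_coord_eq_neg {a : ℕ} (ha : 1 ≤ a) (han : a < n) {c : ℝ}
    (hc : c = 1 ∨ c = -1) {x y : Fin n → ℝ}
    (hxy : ∀ k, a ≤ k → k ≤ n → coord y k = (if k = n then c else -1) * coord x k)
    (hx : ∀ i, a ≤ i → i ≤ n → wall n i x ≤ 0) {i : ℕ} (hai : a ≤ i) (hin : i ≤ n) :
    0 ≤ wall n i y := by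
  have hlast := hx n han.le le_rfl
  have hpen := hx (n - 1) (by omega) (by omega)
  rw [wall_last (by omega)] at hlast
  rw [wall_of_lt (by omega) (by omega), Nat.sub_add_cancel (by omega)] at hpen
  obtain rfl | hin' := hin.eq_or_lt
  · rw [wall_last (by omega), hxy _ (by omega) (by omega), hxy _ (by omega) le_rfl,
      if_neg (by omega), if_pos rfl]
    rcases hc with rfl | rfl <;> linarith
  · have hi' := hx i hai hin
    rw [wall_of_lt (by omega) hin'] at hi' ⊢
    rw [hxy _ hai hin, hxy _ (by omega) hin', if_neg hin'.ne]
    split_ifs with h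
    · obtain rfl : i = n - 1 := by omega
      rw [h]
      rcases hc with rfl | rfl <;> linarith
    · linarith

theorem coord_longest (hn : 4 ≤ n) (x : Fin n → ℝ) {k : ℕ} (hk : 1 ≤ k) (hkn : k ≤ n) :
    coord (longest n (Set.Icc 1 n) x) k = (if k = n then (-1) ^ (n + 1) else -1) * coord x k := by
  let ε : Fin n → ℤˣ := (fun _ => -1) * Pi.mulSingle ⟨n - 1, by omega⟩ ((-1) ^ n)
  have hε : ∏ a, ε a = 1 := by
    simp only [ε, Pi.mul_apply, Finset.prod_mul_distrib, Fintype.prod_pi_mulSingle',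
      Finset.prod_const, Finset.card_univ, Fintype.card_fin, Int.units_mul_self]
  have hcoord : ∀ x k, 1 ≤ k → k ≤ n →
      coord (signedPerm 1 ε x) k = (if k = n then (-1) ^ (n + 1) else -1) * coord x k := by
    intro x k hk hkn
    rw [coord_signedPerm x hk (by omega), Equiv.Perm.one_apply, Nat.sub_add_cancel hk]
    simp only [ε, Pi.mul_apply, Pi.mulSingle_apply, Fin.mk.injEq,
      show k - 1 = n - 1 ↔ k = n by omega]
    split_ifs <;> simp [pow_succ]
  rw [longest_eq hn subset_rfl ⟨1, ε, hε, rfl⟩ (signedPerm_mul_self rfl fun _ => rfl) (by simp) ?_,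
    hcoord x k hk hkn]
  exact fun x hx i hi => wall_nonneg_of_coord_eq_neg le_rfl (by omega) (neg_one_pow_eq_or ℝ _)
    (hcoord x) (fun i hi hin => hx i ⟨hi, hin⟩) hi.1 hi.2

theorem coord_longest_first (hn : 4 ≤ n) (x : Fin n → ℝ) {k : ℕ} (hk : 1 ≤ k) (hkn : k ≤ n) :
    coord (longest n (Set.Icc 1 n \ {1}) x) k =
      (if k = 1 then 1 else if k = n then (-1) ^ n else -1) * coord x k := by
  let ε : Fin n → ℤˣ := (fun _ => -1) * Pi.mulSingle ⟨0, by omega⟩ (-1) *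
    Pi.mulSingle ⟨n - 1, by omega⟩ ((-1) ^ (n + 1))
  have hε : ∏ a, ε a = 1 := by
    simp only [ε, Pi.mul_apply, Finset.prod_mul_distrib, Fintype.prod_pi_mulSingle',
      Finset.prod_const, Finset.card_univ, Fintype.card_fin, ← pow_succ, Int.units_mul_self]
  have hcoord : ∀ x k, 1 ≤ k → k ≤ n → coord (signedPerm 1 ε x) k =
      (if k = 1 then 1 else if k = n then (-1) ^ n else -1) * coord x k := by
    intro x k hk hkn
    rw [coord_signedPerm x hk (by omega), Equiv.Perm.one_apply, Nat.sub_add_cancel hk]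
    simp only [ε, Pi.mul_apply, Pi.mulSingle_apply, Fin.mk.injEq,
      show k - 1 = 0 ↔ k = 1 by omega, show k - 1 = n - 1 ↔ k = n by omega]
    split_ifs <;> first | omega | simp [pow_succ]
  rw [longest_eq hn Set.sdiff_subset ⟨1, ε, hε, rfl⟩ (signedPerm_mul_self rfl fun _ => rfl) ?_ ?_,
    hcoord x k hk hkn]
  · intro j hj
    obtain rfl : j = 1 := by grind
    refine coord_ext fun k hk hkn => ?_
    rw [hcoord _ k hk hkn, coord_fundamentalWeight hn hk hkn]
    grind
  · refine fun x hx i hi => wall_nonneg_of_coord_eq_neg one_le_two (by omega)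
      (neg_one_pow_eq_or ℝ n) (fun k hk hkn => ?_)
      (fun i hi hin => hx i ⟨⟨by omega, hin⟩, by grind⟩) ?_ hi.1.2
    · rw [hcoord x k (by omega) hkn, if_neg (by omega)]
    · grind

theorem coord_longest_last (hn : 4 ≤ n) (x : Fin n → ℝ) {k : ℕ} (hk : 1 ≤ k) (hkn : k ≤ n) :
    coord (longest n (Set.Icc 1 n \ {n}) x) k = coord x (n + 1 - k) := by
  have hcoord : ∀ x k, 1 ≤ k → k ≤ n →
      coord (signedPerm (Fin.revPerm : Equiv.Perm (Fin n)) 1 x) k = coord x (n + 1 - k) := by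
    intro x k hk hkn
    rw [coord_signedPerm x hk (by omega), Pi.one_apply, Units.val_one, Int.cast_one, one_mul]
    simp only [Fin.revPerm_apply, Fin.val_rev]
    congr 1
    omega
  rw [longest_eq hn Set.sdiff_subset ⟨Fin.revPerm, 1, by simp, rfl⟩
    (signedPerm_mul_self (by ext; simp) fun _ => rfl) ?_ ?_, hcoord x k hk hkn]
  · intro j hj
    obtain rfl : j = n := by grind
    refine coord_ext fun k hk hkn => ?_
    rw [hcoord _ k hk hkn, coord_fundamentalWeight hn hk hkn,
      coord_fundamentalWeight hn (by omega) (by omega)]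
    grind
  · rintro x hx i ⟨⟨hi, hin⟩, hi'⟩
    have hin' : i < n := lt_of_le_of_ne hin hi'
    have hwall := hx (n - i) ⟨⟨by omega, by omega⟩, by grind⟩
    rw [wall_of_lt (by omega) (by omega)] at hwall ⊢
    rw [hcoord _ _ hi hin, hcoord _ _ (by omega) hin']
    grind

theorem wall_nonneg_of_coord_eq_rev (hn : 3 ≤ n) {x y : Fin n → ℝ}
    (hxy : ∀ k, 1 ≤ k → k ≤ n →
      coord y k = (if k = 1 ∨ k = n then -1 else 1) * coord x (n + 1 - k))
    (hx : ∀ i ∈ Set.Icc 1 n \ {n - 1}, wall n i x ≤ 0) {i : ℕ} (hi : i ∈ Set.Icc 1 n \ {n - 1}) :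
    0 ≤ wall n i y := by
  obtain ⟨⟨hi, hin⟩, hi'⟩ := hi
  have hfirst := hx 1 ⟨⟨le_rfl, by omega⟩, by grind⟩
  have hlast := hx n ⟨⟨by omega, le_rfl⟩, by grind⟩
  rw [wall_of_lt le_rfl (by omega)] at hfirst
  rw [wall_last (by omega)] at hlast
  obtain rfl | hin' := hin.eq_or_lt
  · rw [wall_last (by omega), hxy _ (by omega) (by omega), hxy _ hi le_rfl]
    grind
  · rw [wall_of_lt hi hin', hxy _ hi hin, hxy _ (by omega) hin']
    obtain rfl | hi1 := hi.eq_or_lt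
    · rw [if_pos (.inl rfl), if_neg (by omega)]
      grind
    · have hwall := hx (n - i) ⟨⟨by omega, by omega⟩, by grind⟩
      rw [wall_of_lt (by omega) (by omega)] at hwall
      rw [if_neg (by omega), if_neg (by grind)]
      grind

theorem coord_longest_penultimate (hn : 4 ≤ n) (x : Fin n → ℝ) {k : ℕ} (hk : 1 ≤ k)
    (hkn : k ≤ n) :
    coord (longest n (Set.Icc 1 n \ {n - 1}) x) k =
      (if k = 1 ∨ k = n then -1 else 1) * coord x (n + 1 - k) := by
  let ε : Fin n → ℤˣ := Pi.mulSingle ⟨0, by omega⟩ (-1) * Pi.mulSingle ⟨n - 1, by omega⟩ (-1)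
  have hε : ∏ a, ε a = 1 := by
    simp only [ε, Pi.mul_apply, Finset.prod_mul_distrib, Fintype.prod_pi_mulSingle',
      Int.units_mul_self]
  have hcoord : ∀ x k, 1 ≤ k → k ≤ n → coord (signedPerm Fin.revPerm ε x) k =
      (if k = 1 ∨ k = n then -1 else 1) * coord x (n + 1 - k) := by
    intro x k hk hkn
    rw [coord_signedPerm x hk (by omega)]
    simp only [ε, Pi.mul_apply, Pi.mulSingle_apply, Fin.mk.injEq, Fin.revPerm_apply, Fin.val_rev,
      show k - 1 = 0 ↔ k = 1 by omega, show k - 1 = n - 1 ↔ k = n by omega,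
      show n - (k - 1 + 1) + 1 = n + 1 - k by omega]
    split_ifs <;> first | omega | simp
  have hrev : ∀ a, ε (Fin.revPerm a) = ε a := fun a => by
    simp only [ε, Pi.mul_apply, Pi.mulSingle_apply, Fin.revPerm_apply, Fin.ext_iff, Fin.val_rev]
    grind
  rw [longest_eq hn Set.sdiff_subset ⟨Fin.revPerm, ε, hε, rfl⟩
    (signedPerm_mul_self (by ext; simp) hrev) ?_ ?_, hcoord x k hk hkn]
  · intro j hj
    obtain rfl : j = n - 1 := by grind
    refine coord_ext fun k hk hkn => ?_
    rw [hcoord _ k hk hkn, coord_fundamentalWeight hn hk hkn,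
      coord_fundamentalWeight hn (by omega) (by omega)]
    grind
  · exact fun x hx i hi => wall_nonneg_of_coord_eq_rev (by omega) (hcoord x) hx hi

theorem coord_diagramAut_first (hn : 4 ≤ n) (x : Fin n → ℝ) {k : ℕ} (hk : 1 ≤ k) (hkn : k ≤ n) :
    coord (diagramAut n 1 x) k =
      if k = 1 then 1 - coord x 1 else if k = n then -coord x n else coord x k := by
  rw [diagramAut, mul_apply, mul_apply, coord_translation, coord_longest_first hn _ hk hkn,
    coord_longest hn _ hk hkn, coord_fundamentalWeight hn hk hkn]
  rcases neg_one_pow_eq_or ℝ n with h | h <;> simp only [pow_succ, h] <;> grind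

theorem coord_diagramAut_last (hn : 4 ≤ n) (x : Fin n → ℝ) {k : ℕ} (hk : 1 ≤ k) (hkn : k ≤ n) :
    coord (diagramAut n n x) k =
      if k = 1 then 1 / 2 + (-1) ^ (n + 1) * coord x n else 1 / 2 - coord x (n + 1 - k) := by
  rw [diagramAut, mul_apply, mul_apply, coord_translation, coord_longest_last hn _ hk hkn,
    coord_longest hn _ (by omega) (by omega), coord_fundamentalWeight hn hk hkn]
  generalize ((-1 : ℝ)) ^ (n + 1) = c
  grind

theorem coord_diagramAut_penultimate (hn : 4 ≤ n) (x : Fin n → ℝ) {k : ℕ} (hk : 1 ≤ k)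
    (hkn : k ≤ n) :
    coord (diagramAut n (n - 1) x) k =
      if k = 1 then 1 / 2 - (-1) ^ (n + 1) * coord x n
      else if k = n then coord x 1 - 1 / 2 else 1 / 2 - coord x (n + 1 - k) := by
  rw [diagramAut, mul_apply, mul_apply, coord_translation, coord_longest_penultimate hn _ hk hkn,
    coord_longest hn _ (by omega) (by omega), coord_fundamentalWeight hn hk hkn]
  generalize ((-1 : ℝ)) ^ (n + 1) = c
  grind

theorem longest_mem_extAffineWeyl (hn : 2 ≤ n) {I : Set ℕ} (hI : I ⊆ Set.Icc 1 n) :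
    longest n I ∈ extAffineWeyl n :=
  Subgroup.mem_sup_left
    (Subgroup.closure_mono (Set.image_mono hI) (isLongest_longest hn hI).1)

theorem fundamentalWeight_mem_weightLattice (hn : 4 ≤ n) {i : ℕ} (hi : i ≤ n) :
    fundamentalWeight n i ∈ weightLattice n := fun j hj hjn =>
  ⟨if i = j then 1 else 0, by
    rw [simpleRoot_dot_fundamentalWeight n i j hn hi hj hjn]
    push_cast
    rfl⟩

theorem diagramAut_mem_extAffineWeyl (hn : 4 ≤ n) {j : ℕ} (hj : j ≤ n) :
    diagramAut n j ∈ extAffineWeyl n :=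
  mul_mem (mul_mem
    (Subgroup.mem_sup_right
      (Subgroup.subset_closure ⟨_, fundamentalWeight_mem_weightLattice hn hj, rfl⟩))
    (longest_mem_extAffineWeyl (by omega) Set.sdiff_subset))
    (longest_mem_extAffineWeyl (by omega) subset_rfl)

theorem wall_eq_coord (hn : 2 ≤ n) {j : ℕ} (hj : j ≤ n) (x : Fin n → ℝ) :
    wall n j x = if j = 0 then 1 - (coord x 1 + coord x 2)
      else if j = n then coord x (n - 1) + coord x n else coord x j - coord x (j + 1) := by
  split_ifs with h0 hjn
  · rw [h0, wall_zero hn]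
  · rw [hjn, wall_last hn]
  · exact wall_of_lt (by omega) (by omega) x

theorem diagramAut_first_mem (hn : 4 ≤ n) : diagramAut n 1 ∈ diagramGroup n := by
  have hcoord := fun x {k} => @coord_diagramAut_first n hn x k
  refine mem_diagramGroup_of_wall (by omega) (diagramAut_mem_extAffineWeyl hn (by omega))
    fun k hk => ⟨if k = 0 then 1 else if k = 1 then 0 else if k = n - 1 then n
      else if k = n then n - 1 else k, by grind, fun x => ?_⟩
  rw [wall_eq_coord (by omega) (by grind), wall_eq_coord (by omega) hk]
  grind

theorem diagramAut_last_mem (hn : 4 ≤ n) : diagramAut n n ∈ diagramGroup n := by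
  have hcoord := fun x {k} => @coord_diagramAut_last n hn x k
  refine mem_diagramGroup_of_wall (by omega) (diagramAut_mem_extAffineWeyl hn le_rfl) ?_
  rcases Nat.even_or_odd n with hp | hp <;> rw [hp.add_one.neg_one_pow] at hcoord <;> intro k hk
  · refine ⟨n - k, by omega, fun x => ?_⟩
    rw [wall_eq_coord (by omega) (by omega), wall_eq_coord (by omega) hk]
    grind
  · refine ⟨if k = n then 1 else if k = n - 1 then 0 else n - k, by grind, fun x => ?_⟩
    rw [wall_eq_coord (by omega) (by grind), wall_eq_coord (by omega) hk]
    grind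

theorem diagramAut_penultimate_mem (hn : 4 ≤ n) : diagramAut n (n - 1) ∈ diagramGroup n := by
  have hcoord := fun x {k} => @coord_diagramAut_penultimate n hn x k
  refine mem_diagramGroup_of_wall (by omega) (diagramAut_mem_extAffineWeyl hn (by omega)) ?_
  rcases Nat.even_or_odd n with hp | hp <;> rw [hp.add_one.neg_one_pow] at hcoord <;> intro k hk
  · refine ⟨if k = 0 then n - 1 else if k = 1 then n else if k = n then 1
      else if k = n - 1 then 0 else n - k, by grind, fun x => ?_⟩
    rw [wall_eq_coord (by omega) (by grind), wall_eq_coord (by omega) hk]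
    grind
  · refine ⟨if k = 0 then n - 1 else if k = 1 then n else n - k, by grind, fun x => ?_⟩
    rw [wall_eq_coord (by omega) (by grind), wall_eq_coord (by omega) hk]
    grind

theorem translation_eq_rotationWord_cyclicWord (hn : 4 ≤ n) {m : ℕ} (hm : 1 ≤ m)
    (hmn : 2 * m + 2 ≤ n) :
    translation n (fundamentalWeight n (2 * m)) =
      1 * wordProd n (wordPow (rotationWord n) m ++ cyclicWord n (2 * m)) := by
  ext1 x
  refine coord_ext fun p hp hpn => ?_
  have hcyclic := fun {p} => @coord_cyclicWord n (2 * m) (by omega) (by omega) x p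
  rw [one_mul, wordProd_append, mul_apply, coord_translation, coord_fundamentalWeight hn hp hpn,
    coord_wordPow_rotationWord hn (by omega) _ hp hpn]
  grind

theorem coord_diagramAut_first_mul (hn : 4 ≤ n) (x : Fin n → ℝ) {p : ℕ} (hp : 1 ≤ p)
    (hpn : p ≤ n) :
    coord (diagramAut n 1 (wordProd n (block 1 (n - 2) ++ [n]) x)) p =
      if p = 1 then 1 + coord x n else coord x (p - 1) := by
  have hword := fun {p} => @coord_block_one_append_last n (by omega) x p
  rw [coord_diagramAut_first hn _ hp hpn]
  grind

theorem translation_eq_diagramAut_first_mul (hn : 4 ≤ n) {m : ℕ} (hmn : 2 * m + 3 ≤ n) :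
    translation n (fundamentalWeight n (2 * m + 1)) = diagramAut n 1 * wordProd n
      (block 1 (n - 2) ++ [n] ++ wordPow (rotationWord n) m ++ cyclicWord n (2 * m + 1)) := by
  ext1 x
  refine coord_ext fun p hp hpn => ?_
  rw [wordProd_append, wordProd_append, mul_apply, mul_apply, mul_apply, coord_translation,
    coord_fundamentalWeight hn hp hpn, coord_diagramAut_first_mul hn _ hp hpn,
    if_pos (show 2 * m + 1 + 2 ≤ n from hmn)]
  have hcyclic := fun {p} => @coord_cyclicWord n (2 * m + 1) (by omega) (by omega) x p
  split_ifs <;>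
    first | omega | rw [coord_wordPow_rotationWord hn (by omega) _ (by omega) (by omega)]
  all_goals grind

theorem coord_penultimate_pair (hn : 3 ≤ n) (x : Fin n → ℝ) (p : ℕ) :
    coord (wordProd n ([n - 1] ++ [n - 2]) x) p =
      if p = n - 2 then coord x (n - 1) else if p = n - 1 then coord x n
      else if p = n then coord x (n - 2) else coord x p := by
  rw [wordProd_append, mul_apply, wordProd_singleton, wordProd_singleton]
  simp only [coord_s (show 1 ≤ n - 1 by omega) (show n - 1 < n by omega),
    coord_s (show 1 ≤ n - 2 by omega) (show n - 2 < n by omega)]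
  grind

theorem translation_eq_diagramAut_last_mul (hn : 4 ≤ n) {g : AffineGroup n}
    (hg : ∀ x p, 1 ≤ p → p ≤ n →
      coord (g x) p = if p = n then (-1) ^ (n + 1) * coord x 1 else -coord x (n + 1 - p)) :
    translation n (fundamentalWeight n n) = diagramAut n n * g := by
  ext1 x
  refine coord_ext fun p hp hpn => ?_
  rw [mul_apply, coord_diagramAut_last hn _ hp hpn, coord_translation,
    coord_fundamentalWeight hn hp hpn]
  rcases neg_one_pow_eq_or ℝ (n + 1) with h | h <;> rw [h] at hg ⊢ <;> grind

theorem translation_eq_diagramAut_penultimate_mul (hn : 4 ≤ n) {g : AffineGroup n}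
    (hg : ∀ x p, 1 ≤ p → p ≤ n → coord (g x) p =
      if p = 1 then coord x n else if p = n then (-1) ^ n * coord x 1 else -coord x (n + 1 - p)) :
    translation n (fundamentalWeight n (n - 1)) = diagramAut n (n - 1) * g := by
  ext1 x
  refine coord_ext fun p hp hpn => ?_
  rw [mul_apply, coord_diagramAut_penultimate hn _ hp hpn, coord_translation,
    coord_fundamentalWeight hn hp hpn, pow_succ]
  rcases neg_one_pow_eq_or ℝ n with h | h <;> rw [h] at hg ⊢ <;> split_ifs <;>
    first | omega | rw [hg x _ (by omega) (by omega)]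
  all_goals grind

theorem translation_eq_last_even {m : ℕ} (hn : 4 ≤ n) (hnm : n = 2 * m + 2) :
    translation n (fundamentalWeight n n) =
      diagramAut n n * wordProd n (rChain n (2 * m) 2 ++ [n]) := by
  refine translation_eq_diagramAut_last_mul hn fun x p hp hpn => ?_
  rw [coord_rChain_append_last (by omega) (by omega) x hp hpn,
    Odd.neg_one_pow ⟨m + 1, by omega⟩]
  grind

theorem translation_eq_last_odd {m : ℕ} (hn : 4 ≤ n) (hnm : n = 2 * m + 3) :
    translation n (fundamentalWeight n n) =
      diagramAut n n * wordProd n ([n - 1] ++ [n - 2] ++ (rChain n (2 * m) 2 ++ [n])) := by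
  refine translation_eq_diagramAut_last_mul hn fun x p hp hpn => ?_
  rw [wordProd_append, mul_apply, coord_penultimate_pair (by omega),
    Even.neg_one_pow ⟨m + 2, by omega⟩]
  split_ifs <;>
    first | omega | rw [coord_rChain_append_last (by omega) (by omega) _ (by omega) (by omega)]
  all_goals grind

theorem translation_eq_penultimate_even {m : ℕ} (hn : 4 ≤ n) (hnm : n = 2 * m + 3) :
    translation n (fundamentalWeight n (n - 1)) =
      diagramAut n (n - 1) * wordProd n (rChain n (2 * m + 1) 3 ++ [n] ++ block 1 (n - 1)) := by
  refine translation_eq_diagramAut_penultimate_mul hn fun x p hp hpn => ?_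
  rw [coord_rChain_append_last_block (by omega) (by omega) x hp hpn,
    Odd.neg_one_pow ⟨m + 1, by omega⟩]
  grind

theorem translation_eq_penultimate_odd {m : ℕ} (hn : 4 ≤ n) (hnm : n = 2 * m + 4) :
    translation n (fundamentalWeight n (n - 1)) = diagramAut n (n - 1) * wordProd n
      ([n - 1] ++ [n - 2] ++ (rChain n (2 * m + 1) 3 ++ [n] ++ block 1 (n - 1))) := by
  refine translation_eq_diagramAut_penultimate_mul hn fun x p hp hpn => ?_
  rw [wordProd_append, mul_apply, coord_penultimate_pair (by omega),
    Even.neg_one_pow ⟨m + 2, by omega⟩]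
  split_ifs <;>
    first
    | omega
    | rw [coord_rChain_append_last_block (by omega) (by omega) _ (by omega) (by omega)]
  all_goals grind

theorem sep_basePoint_sub_fundamentalWeight (hn : 4 ≤ n) {i : ℕ} (hin : i + 2 ≤ n) :
    sep (basePoint n - fundamentalWeight n i) = i * (2 * n - i - 1) := by
  have hcoord {a : ℕ} (ha : 1 ≤ a) (han : a ≤ n) :
      coord (fundamentalWeight n i) a = if a ≤ i then 1 else 0 := by
    rw [coord_fundamentalWeight hn ha han, if_pos hin]
  have hpartial : ∀ m ≤ n,
      ∑ a ∈ Finset.Icc 1 m, 2 * ((n : ℝ) - a) * coord (fundamentalWeight n i) a =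
        (min i m : ℕ) * (2 * n - (min i m : ℕ) - 1) := by
    intro m hm
    induction m with
    | zero => simp
    | succ m ih =>
      rw [Finset.sum_Icc_succ_top (by omega), ih (by omega), hcoord (by omega) hm]
      split_ifs with hmi
      · rw [min_eq_right hmi, min_eq_right (by omega)]
        push_cast; ring
      · rw [min_eq_left (by omega), min_eq_left (by omega)]
        ring
  rify
  rw [sep_basePoint_sub, hpartial n le_rfl, min_eq_left (by omega), Nat.cast_sub (by omega),
    Nat.cast_sub (by omega)]
  · push_cast; ring
  · intro a b ha hab hb
    rw [hcoord ha (by omega), hcoord (by omega) hb]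
    split_ifs
    · exact ⟨0, 2, by norm_num, by norm_num⟩
    · exact ⟨1, 1, by norm_num, by norm_num⟩
    · omega
    · exact ⟨0, 0, by norm_num, by norm_num⟩

theorem two_mul_sep_basePoint_sub_spinWeight (hn : 4 ≤ n) {i : ℕ} (hi : n ≤ i + 1) :
    2 * sep (basePoint n - fundamentalWeight n i) = n * (n - 1) := by
  have hterm : ∀ a ∈ Finset.Icc 1 n,
      2 * ((n : ℝ) - a) * coord (fundamentalWeight n i) a = (n : ℝ) - a := by
    intro a ha
    rw [Finset.mem_Icc] at ha
    rw [coord_fundamentalWeight hn ha.1 ha.2, if_neg (by omega)]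
    split_ifs with h
    · rw [h.2]; ring
    · ring
  have hsum (m : ℕ) : ∑ a ∈ Finset.Icc 1 m, ((n : ℝ) - a) = m * n - m * (m + 1) / 2 := by
    induction m with
    | zero => simp
    | succ m ih =>
      rw [Finset.sum_Icc_succ_top (by omega), ih]
      push_cast; ring
  rify
  rw [sep_basePoint_sub, Finset.sum_congr rfl hterm, hsum, Nat.cast_sub (by omega)]
  · push_cast; ring
  · intro a b ha hab hb
    rw [coord_fundamentalWeight hn ha (by omega), coord_fundamentalWeight hn (by omega) hb,
      if_neg (by omega), if_neg (by omega), if_neg (by omega)]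
    split_ifs
    · exact ⟨1, 0, by norm_num, by norm_num⟩
    · exact ⟨0, 1, by norm_num, by norm_num⟩

theorem isReducedExpression_fundamentalWeight (hn : 4 ≤ n) {i : ℕ} {lam : AffineGroup n}
    {L : List ℕ} (hin : i + 2 ≤ n) (hlam : lam ∈ diagramGroup n) (hL : ∀ j ∈ L, j ≤ n)
    (h : translation n (fundamentalWeight n i) = lam * wordProd n L)
    (hlen : L.length = i * (2 * n - i - 1)) :
    IsReducedExpression n (translation n (fundamentalWeight n i)) lam L :=
  isReducedExpression_translation hn hlam hL h
    (hlen.trans (sep_basePoint_sub_fundamentalWeight hn hin).symm)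

theorem isReducedExpression_spinWeight (hn : 4 ≤ n) {i : ℕ} {lam : AffineGroup n}
    {L : List ℕ} (hi : n ≤ i + 1) (hlam : lam ∈ diagramGroup n) (hL : ∀ j ∈ L, j ≤ n)
    (h : translation n (fundamentalWeight n i) = lam * wordProd n L)
    (hlen : 2 * L.length = n * (n - 1)) :
    IsReducedExpression n (translation n (fundamentalWeight n i)) lam L := by
  have hsep := two_mul_sep_basePoint_sub_spinWeight hn hi
  exact isReducedExpression_translation hn hlam hL h (by omega)

theorem length_expression_even {i : ℕ} (hi : Even i) (hi2 : 2 ≤ i) (hin : i ≤ n - 2) :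
    (wordPow (rotationWord n) (i / 2) ++ cyclicWord n i).length = i * (2 * n - i - 1) := by
  rw [List.length_append, length_wordPow, length_rotationWord (by omega),
    length_cyclicWord (by omega) (by omega)]
  obtain ⟨m, rfl⟩ := even_iff_exists_two_mul.1 hi
  rw [Nat.mul_div_cancel_left m two_pos]
  zify [show 2 * m ≤ n by omega, show 1 ≤ n by omega, show 2 * m ≤ 2 * n by omega,
    show 1 ≤ 2 * n - 2 * m by omega]
  ring

theorem length_expression_odd {i : ℕ} (hi : Odd i) (hin : i ≤ n - 2) :
    (block 1 (n - 2) ++ [n] ++ wordPow (rotationWord n) ((i - 1) / 2) ++ cyclicWord n i).length =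
      i * (2 * n - i - 1) := by
  obtain ⟨m, rfl⟩ := hi
  rw [List.length_append, List.length_append, List.length_append, length_wordPow,
    length_rotationWord (by omega), length_block, List.length_singleton,
    length_cyclicWord (by omega) (by omega), Nat.add_sub_cancel, Nat.add_sub_cancel,
    Nat.mul_div_cancel_left m two_pos]
  zify [show 2 * m + 1 ≤ n by omega, show 2 ≤ n by omega, show 1 ≤ n by omega,
    show 2 * m + 1 ≤ 2 * n by omega, show 1 ≤ 2 * n - (2 * m + 1) by omega]
  ring

theorem two_mul_length_expression_penultimate_even (hn : 2 ≤ n) (hp : Even (n - 1)) :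
    2 * (rChain n (n - 2) 3 ++ [n] ++ block 1 (n - 1)).length = n * (n - 1) := by
  obtain ⟨m, rfl⟩ : ∃ m, n = 2 * m + 3 := ⟨(n - 3) / 2, by grind⟩
  simp only [List.length_append, List.length_singleton, length_block]
  rw [show 2 * m + 3 - 2 = 3 + 2 * m - 2 by omega, length_rChain (by omega) (by omega),
    show 2 * (2 * m + 3) + 3 - 2 * 3 - 2 * m = 2 * m + 3 by omega]
  grind

theorem two_mul_length_expression_penultimate_odd (hn : 3 ≤ n) (hp : Odd (n - 1)) :
    2 * ([n - 1] ++ [n - 2] ++ rChain n (n - 3) 3 ++ [n] ++ block 1 (n - 1)).length =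
      n * (n - 1) := by
  obtain ⟨m, rfl⟩ : ∃ m, n = 2 * m + 4 := ⟨(n - 4) / 2, by grind⟩
  simp only [List.length_append, List.length_singleton, length_block]
  rw [show 2 * m + 4 - 3 = 3 + 2 * m - 2 by omega, length_rChain (by omega) (by omega),
    show 2 * (2 * m + 4) + 3 - 2 * 3 - 2 * m = 2 * m + 5 by omega]
  grind

theorem two_mul_length_expression_last_even (hn : 2 ≤ n) (hp : Even n) :
    2 * (rChain n (n - 2) 2 ++ [n]).length = n * (n - 1) := by
  obtain ⟨m, rfl⟩ : ∃ m, n = 2 * m + 2 := ⟨(n - 2) / 2, by grind⟩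
  simp only [List.length_append, List.length_singleton]
  rw [show 2 * m + 2 - 2 = 2 + 2 * m - 2 by omega, length_rChain le_rfl (by omega),
    show 2 * (2 * m + 2) + 3 - 2 * 2 - 2 * m = 2 * m + 3 by omega]
  grind

theorem two_mul_length_expression_last_odd (hn : 2 ≤ n) (hp : Odd n) :
    2 * ([n - 1] ++ [n - 2] ++ rChain n (n - 3) 2 ++ [n]).length = n * (n - 1) := by
  obtain ⟨m, rfl⟩ : ∃ m, n = 2 * m + 3 := ⟨(n - 3) / 2, by grind⟩
  simp only [List.length_append, List.length_singleton]
  rw [show 2 * m + 3 - 3 = 2 + 2 * m - 2 by omega, length_rChain le_rfl (by omega),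
    show 2 * (2 * m + 3) + 3 - 2 * 2 - 2 * m = 2 * m + 5 by omega]
  grind

theorem isReducedExpression_even (hn : 4 ≤ n) {i : ℕ} (hi : Even i) (hi2 : 2 ≤ i)
    (hin : i ≤ n - 2) :
    IsReducedExpression n (translation n (fundamentalWeight n i)) 1
      (wordPow (rotationWord n) (i / 2) ++ cyclicWord n i) := by
  refine isReducedExpression_fundamentalWeight hn (by omega) (one_mem _) (fun j hj => ?_) ?_
    (length_expression_even hi hi2 hin)
  · rcases List.mem_append.1 hj with h | h
    · exact le_of_mem_wordPow (fun _ => le_of_mem_rotationWord) h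
    · exact le_of_mem_cyclicWord h
  · obtain ⟨m, rfl⟩ := even_iff_exists_two_mul.1 hi
    rw [Nat.mul_div_cancel_left m two_pos]
    exact translation_eq_rotationWord_cyclicWord hn (by omega) (by omega)

theorem isReducedExpression_odd (hn : 4 ≤ n) {i : ℕ} (hi : Odd i) (hin : i ≤ n - 2) :
    IsReducedExpression n (translation n (fundamentalWeight n i)) (diagramAut n 1)
      (block 1 (n - 2) ++ [n] ++ wordPow (rotationWord n) ((i - 1) / 2) ++ cyclicWord n i) := by
  refine isReducedExpression_fundamentalWeight hn (by omega) (diagramAut_first_mem hn)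
    (fun j hj => ?_) ?_ (length_expression_odd hi hin)
  · simp only [List.mem_append, List.mem_singleton] at hj
    obtain ((h | rfl) | h) | h := hj
    · exact le_of_mem_block (by omega) h
    · exact le_rfl
    · exact le_of_mem_wordPow (fun _ => le_of_mem_rotationWord) h
    · exact le_of_mem_cyclicWord h
  · obtain ⟨m, rfl⟩ := hi
    rw [Nat.add_sub_cancel, Nat.mul_div_cancel_left m two_pos]
    exact translation_eq_diagramAut_first_mul hn (by omega)

theorem extLength_fundamentalWeight (hn : 4 ≤ n) {i : ℕ} (hi : 1 ≤ i) (hin : i ≤ n - 2) :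
    extLength n (translation n (fundamentalWeight n i)) = i * (2 * n - i - 1) := by
  rcases Nat.even_or_odd i with hp | hp
  · have hi2 : 2 ≤ i := by grind
    rw [← (isReducedExpression_even hn hp hi2 hin).2.2.2, length_expression_even hp hi2 hin]
  · rw [← (isReducedExpression_odd hn hp hin).2.2.2, length_expression_odd hp hin]

theorem isReducedExpression_penultimate_even (hn : 4 ≤ n) (hp : Even (n - 1)) :
    IsReducedExpression n (translation n (fundamentalWeight n (n - 1))) (diagramAut n (n - 1))
      (rChain n (n - 2) 3 ++ [n] ++ block 1 (n - 1)) := by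
  refine isReducedExpression_spinWeight hn (by omega) (diagramAut_penultimate_mem hn)
    (fun j hj => ?_) ?_ (two_mul_length_expression_penultimate_even (by omega) hp)
  · simp only [List.mem_append, List.mem_singleton] at hj
    obtain (h | rfl) | h := hj
    · exact le_of_mem_rChain h
    · exact le_rfl
    · exact le_of_mem_block (by omega) h
  · obtain ⟨m, hm⟩ : ∃ m, n = 2 * m + 3 := ⟨(n - 3) / 2, by grind⟩
    rw [show n - 2 = 2 * m + 1 by omega]
    exact translation_eq_penultimate_even hn hm

theorem isReducedExpression_penultimate_odd (hn : 4 ≤ n) (hp : Odd (n - 1)) :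
    IsReducedExpression n (translation n (fundamentalWeight n (n - 1))) (diagramAut n (n - 1))
      ([n - 1] ++ [n - 2] ++ rChain n (n - 3) 3 ++ [n] ++ block 1 (n - 1)) := by
  refine isReducedExpression_spinWeight hn (by omega) (diagramAut_penultimate_mem hn)
    (fun j hj => ?_) ?_ (two_mul_length_expression_penultimate_odd (by omega) hp)
  · simp only [List.mem_append, List.mem_singleton] at hj
    obtain (((rfl | rfl) | h) | rfl) | h := hj
    · exact Nat.sub_le n 1
    · exact Nat.sub_le n 2
    · exact le_of_mem_rChain h
    · exact le_rfl
    · exact le_of_mem_block (by omega) h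
  · obtain ⟨m, hm⟩ : ∃ m, n = 2 * m + 4 := ⟨(n - 4) / 2, by grind⟩
    rw [show n - 3 = 2 * m + 1 by omega, List.append_assoc _ [n], List.append_assoc,
      ← List.append_assoc _ [n]]
    exact translation_eq_penultimate_odd hn hm

theorem isReducedExpression_last_even (hn : 4 ≤ n) (hp : Even n) :
    IsReducedExpression n (translation n (fundamentalWeight n n)) (diagramAut n n)
      (rChain n (n - 2) 2 ++ [n]) := by
  refine isReducedExpression_spinWeight hn (by omega) (diagramAut_last_mem hn)
    (fun j hj => ?_) ?_ (two_mul_length_expression_last_even (by omega) hp)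
  · simp only [List.mem_append, List.mem_singleton] at hj
    obtain h | rfl := hj
    · exact le_of_mem_rChain h
    · exact le_rfl
  · obtain ⟨m, hm⟩ : ∃ m, n = 2 * m + 2 := ⟨(n - 2) / 2, by grind⟩
    rw [show n - 2 = 2 * m by omega]
    exact translation_eq_last_even hn hm

theorem isReducedExpression_last_odd (hn : 4 ≤ n) (hp : Odd n) :
    IsReducedExpression n (translation n (fundamentalWeight n n)) (diagramAut n n)
      ([n - 1] ++ [n - 2] ++ rChain n (n - 3) 2 ++ [n]) := by
  refine isReducedExpression_spinWeight hn (by omega) (diagramAut_last_mem hn)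
    (fun j hj => ?_) ?_ (two_mul_length_expression_last_odd (by omega) hp)
  · simp only [List.mem_append, List.mem_singleton] at hj
    obtain ((rfl | rfl) | h) | rfl := hj
    · exact Nat.sub_le n 1
    · exact Nat.sub_le n 2
    · exact le_of_mem_rChain h
    · exact le_rfl
  · obtain ⟨m, hm⟩ : ∃ m, n = 2 * m + 3 := ⟨(n - 3) / 2, by grind⟩
    rw [show n - 3 = 2 * m by omega, List.append_assoc _ _ [n]]
    exact translation_eq_last_odd hn hm

theorem IsReducedExpression.extLength_eq {g lam : AffineGroup n} {L : List ℕ} {N : ℕ}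
    (h : IsReducedExpression n g lam L) (hlen : 2 * L.length = N) : extLength n g = N / 2 := by
  rw [← h.2.2.2, ← hlen, Nat.mul_div_cancel_left _ two_pos]

theorem extLength_penultimateWeight (hn : 4 ≤ n) :
    extLength n (translation n (fundamentalWeight n (n - 1))) = n * (n - 1) / 2 := by
  rcases Nat.even_or_odd (n - 1) with hp | hp
  · exact (isReducedExpression_penultimate_even hn hp).extLength_eq
      (two_mul_length_expression_penultimate_even (by omega) hp)
  · exact (isReducedExpression_penultimate_odd hn hp).extLength_eq
      (two_mul_length_expression_penultimate_odd (by omega) hp)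

theorem extLength_lastWeight (hn : 4 ≤ n) :
    extLength n (translation n (fundamentalWeight n n)) = n * (n - 1) / 2 := by
  rcases Nat.even_or_odd n with hp | hp
  · exact (isReducedExpression_last_even hn hp).extLength_eq
      (two_mul_length_expression_last_even (by omega) hp)
  · exact (isReducedExpression_last_odd hn hp).extLength_eq
      (two_mul_length_expression_last_odd (by omega) hp)

end AffineD

end

theorem mainTheorem5 (n : ℕ) (hn : 4 ≤ n) :
    -- even `i`
    (∀ i, Even i → 2 ≤ i → i ≤ n - 2 →
      AffineD.IsReducedExpression n (AffineD.translation n (AffineD.fundamentalWeight n i)) 1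
        (AffineD.wordPow
            ([0] ++ AffineD.block 2 (n - 1) ++ AffineD.block 1 (n - 2) ++ [n]) (i / 2)
          ++ AffineD.cyclicWord n i)) ∧
    (Even (n - 1) →
      AffineD.IsReducedExpression n (AffineD.translation n (AffineD.fundamentalWeight n (n - 1)))
        (AffineD.diagramAut n (n - 1))
        (AffineD.rChain n (n - 2) 3 ++ [n] ++ AffineD.block 1 (n - 1))) ∧
    (Even n →
      AffineD.IsReducedExpression n (AffineD.translation n (AffineD.fundamentalWeight n n))
        (AffineD.diagramAut n n)
        (AffineD.rChain n (n - 2) 2 ++ [n])) ∧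
    -- odd `i`
    (∀ i, Odd i → 1 ≤ i → i ≤ n - 2 →
      AffineD.IsReducedExpression n (AffineD.translation n (AffineD.fundamentalWeight n i))
        (AffineD.diagramAut n 1)
        (AffineD.block 1 (n - 2) ++ [n]
          ++ AffineD.wordPow
            ([0] ++ AffineD.block 2 (n - 1) ++ AffineD.block 1 (n - 2) ++ [n]) ((i - 1) / 2)
          ++ AffineD.cyclicWord n i)) ∧
    (Odd (n - 1) →
      AffineD.IsReducedExpression n (AffineD.translation n (AffineD.fundamentalWeight n (n - 1)))
        (AffineD.diagramAut n (n - 1))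
        ([n - 1] ++ [n - 2] ++ AffineD.rChain n (n - 3) 3 ++ [n] ++ AffineD.block 1 (n - 1))) ∧
    (Odd n →
      AffineD.IsReducedExpression n (AffineD.translation n (AffineD.fundamentalWeight n n))
        (AffineD.diagramAut n n)
        ([n - 1] ++ [n - 2] ++ AffineD.rChain n (n - 3) 2 ++ [n])) ∧
    -- the lengths
    (∀ i, 1 ≤ i → i ≤ n - 2 →
      AffineD.extLength n (AffineD.translation n (AffineD.fundamentalWeight n i))
        = i * (2 * n - i - 1)) ∧
    AffineD.extLength n (AffineD.translation n (AffineD.fundamentalWeight n (n - 1)))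
      = n * (n - 1) / 2 ∧
    AffineD.extLength n (AffineD.translation n (AffineD.fundamentalWeight n n))
      = n * (n - 1) / 2 :=
  ⟨fun _ hi hi2 hin => AffineD.isReducedExpression_even hn hi hi2 hin,
    AffineD.isReducedExpression_penultimate_even hn,
    AffineD.isReducedExpression_last_even hn,
    fun _ hi _ hin => AffineD.isReducedExpression_odd hn hi hin,
    AffineD.isReducedExpression_penultimate_odd hn,
    AffineD.isReducedExpression_last_odd hn,
    fun _ hi hin => AffineD.extLength_fundamentalWeight hn hi hin,
    AffineD.extLength_penultimateWeight hn, AffineD.extLength_lastWeight hn⟩
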